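/- Let $r$ be a positive integer and let $R=\bigoplus_{\mathbf n\in\mathbb Z^r}R_{\mathbf n}$ be a $\mathbb Z^r$-graded commutative Noetherian ring that is positively graded ($R_{\mathbf n}=0$ unless $\mathbf n\ge\mathbf 0$ componentwise) and standard ($R=R_{\mathbf 0}[R_{\mathbf e_1},\dots,R_{\mathbf e_r}]$, where $\mathbf e_1,\dots,\mathbf e_r$ is the standard basis of $\mathbb Z^r$). Write $\mathbf 1=(1,\dots,1)$. For a graded prime ideal $\mathfrak p$ of $R$, let $\operatorname{dir}(\mathfrak p)=\{j: R_{\mathbf e_j}\subseteq\mathfrak p\}=\{i_1<\dots<i_m\}$, and let $\phi(\mathfrak p):\mathbb Z^r\to\mathbb Z^m$ be the map $(n_1,\dots,n_r)\mapsto(n_{i_1},\dots,n_{i_m})$. For a homomorphism $\phi:\mathbb Z^r\to\mathbb Z^m$ and a $\mathbb Z^r$-graded object $N$ (ring, ideal or module), let $N^{\phi}$ denote the same object with the $\mathbb Z^m$-grading $(N^\phi)_{\mathbf a}=\bigoplus_{\phi(\mathbf n)=\mathbf a}N_{\mathbf n}$. Let $R_{(\mathfrak p)}$ and $M_{(\mathfrak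 p)}$ denote the homogeneous localizations at $\mathfrak p$, obtained by inverting all homogeneous elements of $R\setminus\mathfrak p$, with their natural gradings. Let ${}^*\!\operatorname{Ext}^i$ denote the $i$-th right derived functor, in the category of graded modules and homogeneous homomorphisms of degree $\mathbf 0$, of the graded Hom functor ${}^*\!\operatorname{Hom}(N,M)=\bigoplus_{\mathbf a}\{f\in\operatorname{Hom}(N,M): f(N_{\mathbf g})\subseteq M_{\mathbf g+\mathbf a}\text{ for all }\mathbf g\}$. For a graded prime $\mathfrak p\supseteq R_{\mathbf 1}R$ with $m=\#\operatorname{dir}(\mathfrak p)$, a $\mathbb Z^r$-graded $R$-module $M$ and $i\ge 0$, the set of $i$-th level anchor points of $\mathfrak p$ for $M$ is $$\operatorname{anch}^i(\mathfrak p,M)=\Big\{\mathbf a\in\mathbb Z^m:\Big(\big({}^*\!\operatorname{Ext}^i_{R_{(\mathfrak p)}}(R_{(\mathfrak p)}/\mathfrak pR_{(\mathfrak p)},M_{(\mathfrak p)})\big)^{\phi(\mathfrak p)}\Big)_{\mathbf a}\ne 0\Big\},$$ and the same definition applies to the $\mathbb Z^m$-graded ring $R^{\phi(\mathfrak p)}$,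 its graded prime ideal $\mathfrak p^{\phi(\mathfrak p)}$ and the graded module $M^{\phi(\mathfrak p)}$. **Theorem.** Let $M$ be a $\mathbb Z^r$-graded $R$-module, let $i\ge 0$, and let $\mathfrak p$ be a graded prime ideal of $R$ with $\mathfrak p\supseteq R_{\mathbf 1}R$. Put $m=\#\operatorname{dir}(\mathfrak p)$. Then $\operatorname{dir}(\mathfrak p^{\phi(\mathfrak p)})=\{1,\dots,m\}$, so that $\operatorname{anch}^i(\mathfrak p^{\phi(\mathfrak p)},M^{\phi(\mathfrak p)})$ is again a subset of $\mathbb Z^m$, and $$\operatorname{anch}^i(\mathfrak p,M)=\operatorname{anch}^i(\mathfrak p^{\phi(\mathfrak p)},M^{\phi(\mathfrak p)}).$$ Moreover, if $M$ is finitely generated, this set is finite. -/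

import Mathlib

noncomputable section

namespace MultiGraded

universe u v

/-! ### Coarsening of gradings -/

section Coarsen

variable {G H : Type} [AddCommGroup G] [AddCommGroup H]

/-- The coarsening along `φ : G → H` of a family `(𝒩_g)` of subgroups of an abelian group:
its component in degree `h` is the (internal) sum of the `𝒩_g` with `φ g = h`.  For a `G`-grading
`𝒩` this is the induced `H`-grading. -/
def coarsen {N : Type*} [AddCommGroup N] (φ : G →+ H) (𝒩 : G → AddSubgroup N) (h : H) :
    AddSubgroup N :=
  ⨆ (g : G) (_ : φ g = h), 𝒩 g

theorem le_coarsen {N : Type*} [AddCommGroup N] (φ : G →+ H) (𝒩 : G → AddSubgroup N) (g : G) :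
    𝒩 g ≤ coarsen φ 𝒩 (φ g) :=
  le_iSup₂_of_le (f := fun (g' : G) (_ : φ g' = φ g) => 𝒩 g') g rfl le_rfl

theorem coarsen_smul_mem {R M : Type*} [CommRing R] [AddCommGroup M] [Module R M]
    (φ : G →+ H) (𝒜 : G → AddSubgroup R) (ℳ : G → AddSubgroup M) [SetLike.GradedSMul 𝒜 ℳ]
    {h k : H} {a : R} {x : M} (ha : a ∈ coarsen φ 𝒜 h) (hx : x ∈ coarsen φ ℳ k) :
    a • x ∈ coarsen φ ℳ (h + k) := by
  have key : ∀ g : G, φ g = h → ∀ a ∈ 𝒜 g,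
      coarsen φ ℳ k ≤ (coarsen φ ℳ (h + k)).comap (DistribSMul.toAddMonoidHom M a) := by
    intro g hg a ha
    refine iSup₂_le fun g' hg' y hy => ?_
    have h1 : a • y ∈ ℳ (g + g') := SetLike.GradedSMul.smul_mem ha hy
    have h2 := le_coarsen φ ℳ (g + g') h1
    rw [map_add, hg, hg'] at h2
    exact h2
  have key2 : coarsen φ 𝒜 h ≤
      (coarsen φ ℳ (h + k)).comap ((AddMonoidHom.flip (smulAddHom R M)) x) :=
    iSup₂_le fun g hg a ha => key g hg a ha hx
  exact key2 ha

instance coarsen_gradedMonoid {R : Type*} [CommRing R] (φ : G →+ H) (𝒜 : G → AddSubgroup R)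
    [SetLike.GradedMonoid 𝒜] : SetLike.GradedMonoid (coarsen φ 𝒜) where
  one_mem := by
    have h := le_coarsen φ 𝒜 0 (SetLike.GradedOne.one_mem (A := 𝒜))
    rwa [map_zero] at h
  mul_mem _ _ _ _ ha hb := coarsen_smul_mem φ 𝒜 𝒜 ha hb

instance coarsen_gradedSMul {R M : Type*} [CommRing R] [AddCommGroup M] [Module R M]
    (φ : G →+ H) (𝒜 : G → AddSubgroup R) (ℳ : G → AddSubgroup M) [SetLike.GradedSMul 𝒜 ℳ] :
    SetLike.GradedSMul (coarsen φ 𝒜) (coarsen φ ℳ) where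
  smul_mem _ _ _ _ ha hx := coarsen_smul_mem φ 𝒜 ℳ ha hx

end Coarsen

/-! ### Homogeneous localization -/

section Localization

variable {G : Type} [AddCommGroup G]
variable {R : Type u} [CommRing R] (𝒜 : G → AddSubgroup R) [SetLike.GradedMonoid 𝒜]
variable (p : Ideal R) [p.IsPrime]

/-- The multiplicatively closed set of all homogeneous elements of `R` outside the prime `p`. -/
def homCompl : Submonoid R :=
  SetLike.homogeneousSubmonoid 𝒜 ⊓ p.primeCompl

/-- The homogeneous localization `R_(p)`. -/
abbrev LocRing : Type u := Localization (homCompl 𝒜 p)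

/-- The homogeneous localization `M_(p)`, a module over `R_(p)`. -/
abbrev LocMod (M : Type v) [AddCommGroup M] [Module R M] : Type (max u v) :=
  LocalizedModule (homCompl 𝒜 p) M

/-- The grading of `M_(p)`: the component of degree `g` consists of the fractions `x / s` with
`s` homogeneous outside `p`, of degree `d` say, and `x` homogeneous of degree `g + d`. -/
def locModDeg {M : Type v} [AddCommGroup M] [Module R M] (ℳ : G → AddSubgroup M)
    [SetLike.GradedSMul 𝒜 ℳ] (g : G) : AddSubgroup (LocMod 𝒜 p M) where
  carrier := {z | ∃ (d : G) (s : homCompl 𝒜 p) (x : M),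
    (s : R) ∈ 𝒜 d ∧ x ∈ ℳ (g + d) ∧ z = LocalizedModule.mk x s}
  zero_mem' := ⟨0, 1, 0, SetLike.GradedOne.one_mem, zero_mem _, by simp⟩
  add_mem' := by
    rintro _ _ ⟨d, s, x, hs, hx, rfl⟩ ⟨e, t, y, ht, hy, rfl⟩
    refine ⟨d + e, s * t, t • x + s • y, SetLike.GradedMul.mul_mem hs ht, ?_,
      LocalizedModule.mk_add_mk⟩
    have h1 : (t : R) • x ∈ ℳ (e + (g + d)) := SetLike.GradedSMul.smul_mem ht hx
    have h2 : (s : R) • y ∈ ℳ (d + (g + e)) := SetLike.GradedSMul.smul_mem hs hy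
    rw [show e + (g + d) = g + (d + e) by abel] at h1
    rw [show d + (g + e) = g + (d + e) by abel] at h2
    exact add_mem h1 h2
  neg_mem' := by
    rintro _ ⟨d, s, x, hs, hx, rfl⟩
    exact ⟨d, s, -x, hs, neg_mem hx, LocalizedModule.mk_neg.symm⟩

/-- The grading of `R_(p)`: the component of degree `g` consists of the fractions `x / s` with
`s` homogeneous outside `p`, of degree `d` say, and `x` homogeneous of degree `g + d`. -/
def locRingDeg (g : G) : AddSubgroup (LocRing 𝒜 p) where
  carrier := {z | ∃ (d : G) (s : homCompl 𝒜 p) (x : R),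
    (s : R) ∈ 𝒜 d ∧ x ∈ 𝒜 (g + d) ∧ z = Localization.mk x s}
  zero_mem' := ⟨0, 1, 0, SetLike.GradedOne.one_mem, zero_mem _, (Localization.mk_zero _).symm⟩
  add_mem' := by
    rintro _ _ ⟨d, s, x, hs, hx, rfl⟩ ⟨e, t, y, ht, hy, rfl⟩
    refine ⟨d + e, s * t, s * y + t * x, SetLike.GradedMul.mul_mem hs ht, ?_,
      Localization.add_mk _ _ _ _⟩
    have h1 : (t : R) * x ∈ 𝒜 (e + (g + d)) := SetLike.GradedMul.mul_mem ht hx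
    have h2 : (s : R) * y ∈ 𝒜 (d + (g + e)) := SetLike.GradedMul.mul_mem hs hy
    rw [show e + (g + d) = g + (d + e) by abel] at h1
    rw [show d + (g + e) = g + (d + e) by abel] at h2
    exact add_mem h2 h1
  neg_mem' := by
    rintro _ ⟨d, s, x, hs, hx, rfl⟩
    exact ⟨d, s, -x, hs, neg_mem hx, Localization.neg_mk _ _⟩

end Localization

/-! ### Graded modules, the canonical graded free resolution, and `*Ext` -/

/-- An `A`-module with a family of subgroups indexed by `G`, its homogeneous components. -/
structure GrMod (A : Type u) [CommRing A] (G : Type) where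
  carrier : Type u
  [addCommGroup : AddCommGroup carrier]
  [module : Module A carrier]
  deg : G → AddSubgroup carrier

attribute [instance] GrMod.addCommGroup GrMod.module

section Ext

variable {G : Type} [AddCommGroup G] {A : Type u} [CommRing A] (𝒜 : G → AddSubgroup A)

/-- The graded free module `⨁ A(-g)`, with one summand `A(-g)` for each homogeneous element `x`
of `N` of degree `g`: an element of degree `h` has its coefficient at `x` in `A_{h-g}`. -/
def freeCover (N : GrMod A G) : GrMod A G where
  carrier := (Σ g : G, N.deg g) →₀ A
  deg h :=
    { carrier := {f | ∀ s, f s ∈ 𝒜 (h - s.1)}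
      zero_mem' := fun _ => zero_mem _
      add_mem' := fun ha hb s => add_mem (ha s) (hb s)
      neg_mem' := fun ha s => neg_mem (ha s) }

/-- The homogeneous map of degree `0` from `freeCover N` to `N` that sends the basis element
belonging to `x` to `x`; it is surjective if `N` is generated by its homogeneous elements. -/
def coverMap (N : GrMod A G) : (freeCover 𝒜 N).carrier →ₗ[A] N.carrier :=
  Finsupp.linearCombination A fun s : Σ g : G, N.deg g => (s.2 : N.carrier)

/-- The kernel of `coverMap N`, with the grading induced from `freeCover N`. -/
def syzygy (N : GrMod A G) : GrMod A G where
  carrier := LinearMap.ker (coverMap 𝒜 N)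
  deg h := ((freeCover 𝒜 N).deg h).comap (LinearMap.ker (coverMap 𝒜 N)).subtype.toAddMonoidHom

/-- The iterated syzygies of `N`. -/
def iterSyzygy (N : GrMod A G) : ℕ → GrMod A G
  | 0 => N
  | n + 1 => syzygy 𝒜 (iterSyzygy N n)

/-- The `n`-th term of the canonical graded free resolution
`⋯ → F_1 → F_0 (→ N → 0)` of `N`. -/
abbrev resTerm (N : GrMod A G) (n : ℕ) : GrMod A G :=
  freeCover 𝒜 (iterSyzygy 𝒜 N n)

/-- The inclusion of the `(n+1)`-st syzygy into `F_n`. -/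
def syzygyIncl (N : GrMod A G) (n : ℕ) :
    (iterSyzygy 𝒜 N (n + 1)).carrier →ₗ[A] (resTerm 𝒜 N n).carrier :=
  (LinearMap.ker (coverMap 𝒜 (iterSyzygy 𝒜 N n))).subtype

/-- The differential `F_{n+1} → F_n` of the canonical graded free resolution: the composite of
the cover of the `(n+1)`-st syzygy with its inclusion into `F_n`. -/
def resDiff (N : GrMod A G) (n : ℕ) :
    (resTerm 𝒜 N (n + 1)).carrier →ₗ[A] (resTerm 𝒜 N n).carrier :=
  syzygyIncl 𝒜 N n ∘ₗ coverMap 𝒜 (iterSyzygy 𝒜 N (n + 1))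

variable {M : Type v} [AddCommGroup M] [Module A M] (ℳ : G → AddSubgroup M)

/-- `*Hom_A(F, M)_a`: the `A`-linear maps `f` with `f(F_g) ⊆ M_{g+a}` for all `g`. -/
def starHomDeg (F : GrMod A G) (a : G) : AddSubgroup (F.carrier →ₗ[A] M) where
  carrier := {f | ∀ g, ∀ x ∈ F.deg g, f x ∈ ℳ (g + a)}
  zero_mem' := fun _ _ _ => zero_mem _
  add_mem' := fun hf hg k x hx => add_mem (hf k x hx) (hg k x hx)
  neg_mem' := fun hf k x hx => neg_mem (hf k x hx)

/-- `*Hom_A(F, M)`: the sum of all `*Hom_A(F, M)_a` inside `Hom_A(F, M)`. -/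
def starHom (F : GrMod A G) : AddSubgroup (F.carrier →ₗ[A] M) :=
  ⨆ a : G, starHomDeg ℳ F a

/-- The `i`-cocycles of the complex `*Hom_A(F_•, M)`. -/
def cocycles (N : GrMod A G) (i : ℕ) : AddSubgroup ((resTerm 𝒜 N i).carrier →ₗ[A] M) where
  carrier := {f | f ∈ starHom ℳ (resTerm 𝒜 N i) ∧ f ∘ₗ resDiff 𝒜 N i = 0}
  zero_mem' := ⟨zero_mem _, LinearMap.zero_comp _⟩
  add_mem' := fun hf hg => ⟨add_mem hf.1 hg.1, by rw [LinearMap.add_comp, hf.2, hg.2, add_zero]⟩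
  neg_mem' := fun hf => ⟨neg_mem hf.1, by rw [LinearMap.neg_comp, hf.2, neg_zero]⟩

/-- The `i`-coboundaries of the complex `*Hom_A(F_•, M)`. -/
def coboundaries (N : GrMod A G) : (i : ℕ) → AddSubgroup ((resTerm 𝒜 N i).carrier →ₗ[A] M)
  | 0 => ⊥
  | i + 1 => (starHom ℳ (resTerm 𝒜 N i)).map
      (LinearMap.lcomp A M (resDiff 𝒜 N i)).toAddMonoidHom

/-- `*Ext^i_A(N, M)`, the `i`-th cohomology of `*Hom_A(F_•, M)` where `F_•` is the canonical
graded free resolution of `N`. Only its underlying abelian group and its homogeneous components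
are recorded. -/
abbrev StarExt (N : GrMod A G) (i : ℕ) : Type (max u v) :=
  cocycles 𝒜 ℳ N i ⧸ (coboundaries 𝒜 ℳ N i).addSubgroupOf (cocycles 𝒜 ℳ N i)

/-- The component of degree `a` of `*Ext^i_A(N, M)`: the classes of the cocycles of degree `a`. -/
def starExtDeg (N : GrMod A G) (i : ℕ) (a : G) : AddSubgroup (StarExt 𝒜 ℳ N i) :=
  ((starHomDeg ℳ (resTerm 𝒜 N i) a).addSubgroupOf (cocycles 𝒜 ℳ N i)).map
    (QuotientAddGroup.mk' _)

end Ext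

/-! ### Directions and anchor points -/

section Anchor

variable {R : Type u} [CommRing R] {r : ℕ} (𝒜 : (Fin r → ℤ) → AddSubgroup R)

/-- `R_n = 0` unless `n ≥ 0`. -/
def IsPositivelyGraded : Prop := ∀ n : Fin r → ℤ, ¬ 0 ≤ n → 𝒜 n = ⊥

/-- `R = R_0[R_{e_1}, …, R_{e_r}]`. -/
def IsStandard : Prop :=
  Subring.closure ((𝒜 0 : Set R) ∪ ⋃ j : Fin r, (𝒜 (Pi.single j 1) : Set R)) = ⊤

open Classical in
/-- The set `dir(p)` of `p`-directions: the `j` with `R_{e_j} ⊆ p`. -/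
def dir (p : Ideal R) : Finset (Fin r) :=
  Finset.univ.filter fun j => (𝒜 (Pi.single j 1) : Set R) ⊆ p

/-- The number of `p`-directions. -/
def numDir (p : Ideal R) : ℕ := (dir 𝒜 p).card

/-- `φ(p) : ℤ^r → ℤ^m`, `(n_1, …, n_r) ↦ (n_{i_1}, …, n_{i_m})`, where `i_1 < ⋯ < i_m` are the
`p`-directions. -/
def dirMap (p : Ideal R) : (Fin r → ℤ) →+ (Fin (numDir 𝒜 p) → ℤ) where
  toFun n k := n ((dir 𝒜 p).orderEmbOfFin rfl k)
  map_zero' := rfl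
  map_add' _ _ := rfl

variable [SetLike.GradedMonoid 𝒜] (p : Ideal R) [p.IsPrime]

/-- The graded `R_(p)`-module `R_(p) / p R_(p)`. -/
def resField : GrMod (LocRing 𝒜 p) (Fin r → ℤ) where
  carrier := LocRing 𝒜 p ⧸ p.map (algebraMap R (LocRing 𝒜 p))
  deg n := (locRingDeg 𝒜 p n).map
    (Ideal.Quotient.mk (p.map (algebraMap R (LocRing 𝒜 p)))).toAddMonoidHom

/-- `anch^i(p, M)`: the set of all `a ∈ ℤ^m`, `m` the number of `p`-directions, for which
`(*Ext^i_{R_(p)}(R_(p) / p R_(p), M_(p))^{φ(p)})_a ≠ 0`. -/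
def anch {M : Type v} [AddCommGroup M] [Module R M] (ℳ : (Fin r → ℤ) → AddSubgroup M)
    [SetLike.GradedSMul 𝒜 ℳ] (i : ℕ) : Set (Fin (numDir 𝒜 p) → ℤ) :=
  {a | coarsen (dirMap 𝒜 p)
    (starExtDeg (locRingDeg 𝒜 p) (locModDeg 𝒜 p ℳ) (resField 𝒜 p) i) a ≠ ⊥}

end Anchor

end MultiGraded

end

noncomputable section

namespace MultiGraded

universe u v w

/-! Both sets of anchor points can be read off from one object over `R` itself. Since `R` is
Noetherian, `R/p` has a resolution `P` by graded free modules of finite rank. Its homogeneous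
localization resolves `R_(p)/pR_(p)`, and any two graded free resolutions detect the same nonzero
degrees of `*Ext` (`GrRes.nonvanishingAt_iff`). Let `S` be the set of homogeneous elements outside
`p`. Clearing denominators (`GrRes.nonvanishingAt_localize_iff`) shows that `*Ext^i` is nonzero in
degree `a` exactly when, for some degree `d` of an element of `S`, there is a homogeneous cocycle of
`Hom(P_i, M)` of degree `a + d` that no element of `S` multiplies into the coboundaries. Such a
cocycle is called stable below.

Coarsening along `φ` leaves `P`, its cocycles and its coboundaries unchanged. Only the notion of
degree changes, and `S` grows to the set of `φ`-homogeneous elements outside `p`. The two stability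
conditions still match (`GrRes.stableClassAt_coarsen_iff`). If `t • f` is a coboundary with `f`
homogeneous and `t` outside `p`, then some component of `t` lies outside `p`, and its product with
`f` is a component of `t • f`, hence a coboundary. Conversely, if every fine component of a coarse
cocycle is multiplied into the coboundaries by an element of `S`, then the product of these finitely
many elements does the same to the whole cocycle.

In a standard graded ring every homogeneous element with nonzero degree in a `p`-direction lies in
`p` (`mem_of_mem_dir`). Hence all directions of the coarsened prime are `p`-directions, and its
direction map is the identity up to a cast of index types.

The same fact gives finiteness (`GrRes.finite_stable_degrees`). Write a homogeneous cocycle in terms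
of finitely many homogeneous generators of the module of cocycles. If its `φ`-degree differs from
that of every generator, all coefficients lie in `p`. As `p` annihilates `R/p`, it annihilates the
cohomology, so the cocycle is a coboundary. -/

/-! ### Internal gradings by subgroups -/

/-- The family `𝒩` of subgroups of `N` is an internal grading of `N`. -/
structure IsGrading {G N : Type*} [AddCommGroup N] (𝒩 : G → AddSubgroup N) : Prop where
  indep : ∀ (s : Finset G) (y : G → N), (∀ g ∈ s, y g ∈ 𝒩 g) → ∑ g ∈ s, y g = 0 →
    ∀ g ∈ s, y g = 0
  span : ⨆ g, 𝒩 g = ⊤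

theorem exists_finsupp_of_mem_iSup {G N : Type*} [AddCommGroup N] {𝒩 : G → AddSubgroup N} {x : N}
    (hx : x ∈ ⨆ g, 𝒩 g) : ∃ y : G →₀ N, (∀ g, y g ∈ 𝒩 g) ∧ (y.sum fun _ z => z) = x := by
  classical
  refine AddSubgroup.iSup_induction
    (C := fun x => ∃ y : G →₀ N, (∀ g, y g ∈ 𝒩 g) ∧ (y.sum fun _ z => z) = x) _ hx ?_ ?_ ?_
  · intro g x hx
    refine ⟨Finsupp.single g x, fun h => ?_, by simp⟩
    rw [Finsupp.single_apply]
    split_ifs with e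
    · exact e ▸ hx
    · exact zero_mem _
  · exact ⟨0, fun _ => zero_mem _, by simp⟩
  · rintro _ _ ⟨y, hy, rfl⟩ ⟨z, hz, rfl⟩
    exact ⟨y + z, fun g => add_mem (hy g) (hz g), Finsupp.sum_add_index' (by simp) (by simp)⟩

namespace IsGrading

variable {G N N' : Type*} [AddCommGroup N] [AddCommGroup N']
  {𝒩 : G → AddSubgroup N} {𝒩' : G → AddSubgroup N'}

theorem finsupp_ext (h : IsGrading 𝒩) {y z : G →₀ N} (hy : ∀ g, y g ∈ 𝒩 g)
    (hz : ∀ g, z g ∈ 𝒩 g) (e : (y.sum fun _ x => x) = z.sum fun _ x => x) : y = z := by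
  classical
  have h0 : ((y - z).sum fun _ x => x) = 0 := by
    rw [Finsupp.sum_sub_index (by simp), e, sub_self]
  ext g
  by_cases hg : g ∈ (y - z).support
  · exact sub_eq_zero.mp (h.indep _ (y - z) (fun g _ => sub_mem (hy g) (hz g)) h0 g hg)
  · exact sub_eq_zero.mp (Finsupp.notMem_support_iff.mp hg)

theorem exists_components (h : IsGrading 𝒩) (x : N) :
    ∃ y : G →₀ N, (∀ g, y g ∈ 𝒩 g) ∧ (y.sum fun _ z => z) = x :=
  exists_finsupp_of_mem_iSup (h.span ▸ AddSubgroup.mem_top x)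

/-- The homogeneous components of an element. -/
def components (h : IsGrading 𝒩) (x : N) : G →₀ N := (h.exists_components x).choose

theorem components_mem (h : IsGrading 𝒩) (x : N) (g : G) : h.components x g ∈ 𝒩 g :=
  (h.exists_components x).choose_spec.1 g

theorem components_sum (h : IsGrading 𝒩) (x : N) : ((h.components x).sum fun _ z => z) = x :=
  (h.exists_components x).choose_spec.2

/-- The projection onto the component of degree `g`. -/
def proj (h : IsGrading 𝒩) (g : G) : N →+ N :=
  AddMonoidHom.mk' (fun x => h.components x g) fun x y => by
    rw [← Finsupp.add_apply]
    congr 1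
    refine h.finsupp_ext (h.components_mem _)
      (fun g => add_mem (h.components_mem _ g) (h.components_mem _ g)) ?_
    classical
    rw [Finsupp.sum_add_index' (by simp) (by simp), components_sum, components_sum,
      components_sum]

theorem proj_mem (h : IsGrading 𝒩) (g : G) (x : N) : h.proj g x ∈ 𝒩 g := h.components_mem x g

theorem components_of_mem (h : IsGrading 𝒩) {g : G} {x : N} (hx : x ∈ 𝒩 g) :
    h.components x = Finsupp.single g x := by
  classical
  refine h.finsupp_ext (h.components_mem _) (fun k => ?_) (by simp [components_sum])
  rw [Finsupp.single_apply]
  split_ifs with e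
  · exact e ▸ hx
  · exact zero_mem _

theorem proj_of_mem (h : IsGrading 𝒩) {g : G} {x : N} (hx : x ∈ 𝒩 g) : h.proj g x = x := by
  change h.components x g = x
  rw [h.components_of_mem hx, Finsupp.single_eq_same]

theorem proj_of_ne (h : IsGrading 𝒩) {g k : G} {x : N} (hx : x ∈ 𝒩 g) (hne : g ≠ k) :
    h.proj k x = 0 := by
  change h.components x k = 0
  rw [h.components_of_mem hx, Finsupp.single_eq_of_ne' hne]

theorem mem_of_forall_proj (h : IsGrading 𝒩) (K : AddSubgroup N) {x : N}
    (hx : ∀ g, h.proj g x ∈ K) : x ∈ K := by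
  rw [← h.components_sum x]
  exact sum_mem fun g _ => hx g

theorem eq_zero_of_forall_proj (h : IsGrading 𝒩) {x : N} (hx : ∀ g, h.proj g x = 0) : x = 0 :=
  h.mem_of_forall_proj ⊥ hx

theorem induction (h : IsGrading 𝒩) {motive : N → Prop} (x : N)
    (mem : ∀ g, ∀ x ∈ 𝒩 g, motive x) (zero : motive 0)
    (add : ∀ x y, motive x → motive y → motive (x + y)) : motive x :=
  AddSubgroup.iSup_induction (C := motive) 𝒩 (h.span ▸ AddSubgroup.mem_top x) mem zero add

/-- A homogeneous additive map commutes with the projections. -/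
theorem map_proj {G' : Type*} {𝒩' : G' → AddSubgroup N'} (h : IsGrading 𝒩) (h' : IsGrading 𝒩')
    (σ : G → G') (hσ : Function.Injective σ) (f : N →+ N')
    (hf : ∀ g, ∀ x ∈ 𝒩 g, f x ∈ 𝒩' (σ g)) (g : G) (x : N) :
    f (h.proj g x) = h'.proj (σ g) (f x) := by
  induction x using h.induction with
  | mem k x hx =>
    by_cases e : k = g
    · subst e
      rw [h.proj_of_mem hx, h'.proj_of_mem (hf _ _ hx)]
    · rw [h.proj_of_ne hx e, map_zero, h'.proj_of_ne (hf _ _ hx) (hσ.ne e)]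
  | zero => simp
  | add x y hx hy => simp only [map_add, hx, hy]

theorem eq_zero_of_sum_eq_zero (h : IsGrading 𝒩) {ι : Type*} (s : Finset ι) (y : ι → N)
    (σ : ι → G) (hσ : Function.Injective σ) (hy : ∀ i ∈ s, y i ∈ 𝒩 (σ i))
    (h0 : ∑ i ∈ s, y i = 0) : ∀ i ∈ s, y i = 0 := by
  intro i hi
  have h1 := congrArg (h.proj (σ i)) h0
  rw [map_sum, map_zero, Finset.sum_eq_single_of_mem i hi, h.proj_of_mem (hy i hi)] at h1
  · exact h1
  · intro j hj hne
    exact h.proj_of_ne (hy j hj) (hσ.ne hne)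

/-- The kernel of a homogeneous map is spanned by its homogeneous elements. -/
theorem ker_le_iSup (h : IsGrading 𝒩) (h' : IsGrading 𝒩') (f : N →+ N')
    (hf : ∀ g, ∀ x ∈ 𝒩 g, f x ∈ 𝒩' g) : f.ker ≤ ⨆ g, 𝒩 g ⊓ f.ker := by
  intro x hx
  refine h.mem_of_forall_proj _ fun g => AddSubgroup.mem_iSup_of_mem g ⟨h.proj_mem g x, ?_⟩
  change f _ = 0
  rw [h.map_proj h' id Function.injective_id f hf, AddMonoidHom.mem_ker.mp hx, map_zero]

theorem of_decomposition [DecidableEq G] (𝒩 : G → AddSubgroup N) [DirectSum.Decomposition 𝒩] :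
    IsGrading 𝒩 where
  indep s y hy h0 g hg := by
    have h1 := congrArg (fun x => ((DirectSum.decompose 𝒩 x) g : N)) h0
    simp only [DirectSum.decompose_sum, DirectSum.decompose_zero] at h1
    rw [DFinsupp.finsetSum_apply, AddSubgroup.val_finsetSum,
      Finset.sum_eq_single_of_mem g hg] at h1
    · simpa [DirectSum.decompose_of_mem_same 𝒩 (hy g hg)] using h1
    · intro k hk hne
      exact DirectSum.decompose_of_mem_ne 𝒩 (hy k hk) hne
  span := by
    rw [eq_top_iff]
    rintro x -
    classical
    rw [← DirectSum.sum_support_decompose 𝒩 x]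
    exact sum_mem fun g _ => AddSubgroup.mem_iSup_of_mem g (SetLike.coe_mem _)

/-- A homogeneous ideal, or more generally a subgroup spanned by homogeneous elements, contains
the components of its elements. -/
theorem proj_mem_of_le_iSup (h : IsGrading 𝒩) {K : AddSubgroup N} (hK : K ≤ ⨆ g, 𝒩 g ⊓ K)
    {x : N} (hx : x ∈ K) (g : G) : h.proj g x ∈ K := by
  refine AddSubgroup.iSup_induction (C := fun x => h.proj g x ∈ K) _ (hK hx) ?_ ?_ ?_
  · intro k x hx
    by_cases e : k = g
    · subst e
      rw [h.proj_of_mem hx.1]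
      exact hx.2
    · rw [h.proj_of_ne hx.1 e]
      exact zero_mem _
  · simp
  · intro x y hx hy
    rw [map_add]
    exact add_mem hx hy

/-- The quotient by a kernel spanned by homogeneous elements is graded. -/
theorem map_of_ker_le_iSup (h : IsGrading 𝒩) (f : N →+ N') (hf : Function.Surjective f)
    (hK : f.ker ≤ ⨆ g, 𝒩 g ⊓ f.ker) : IsGrading fun g => (𝒩 g).map f where
  indep s y hy h0 g hg := by
    choose! x hx using hy
    have h1 : ∑ k ∈ s, x k ∈ f.ker := by
      rw [AddMonoidHom.mem_ker, map_sum, ← h0]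
      exact Finset.sum_congr rfl fun k hk => (hx k hk).2
    have h2 := h.proj_mem_of_le_iSup hK h1 g
    rw [map_sum, Finset.sum_eq_single_of_mem g hg, h.proj_of_mem (hx g hg).1,
      AddMonoidHom.mem_ker, (hx g hg).2] at h2
    · exact h2
    · intro k hk hne
      exact h.proj_of_ne (hx k hk).1 hne
  span := by
    rw [← AddSubgroup.map_iSup, h.span]
    exact AddSubgroup.map_top_of_surjective f hf

end IsGrading

/-! ### Components with respect to a coarsened grading. -/

section Coarsen

variable {G H : Type} [AddCommGroup G] [AddCommGroup H] {N : Type*} [AddCommGroup N]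

theorem mem_coarsen_induction {φ : G →+ H} {𝒩 : G → AddSubgroup N} {h : H} {motive : N → Prop}
    {x : N} (hx : x ∈ coarsen φ 𝒩 h) (mem : ∀ g, φ g = h → ∀ x ∈ 𝒩 g, motive x)
    (zero : motive 0) (add : ∀ x y, motive x → motive y → motive (x + y)) : motive x := by
  refine AddSubgroup.iSup_induction (C := motive) _ hx (fun g x hx => ?_) zero add
  exact AddSubgroup.iSup_induction (C := motive) _ hx (fun hg x hx => mem g hg x hx) zero add

theorem IsGrading.proj_of_mem_coarsen {𝒩 : G → AddSubgroup N} (h𝒩 : IsGrading 𝒩) {φ : G →+ H}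
    {h : H} {x : N} (hx : x ∈ coarsen φ 𝒩 h) {g : G} (hg : φ g ≠ h) : h𝒩.proj g x = 0 := by
  refine mem_coarsen_induction (motive := fun x => h𝒩.proj g x = 0) hx ?_ (map_zero _) ?_
  · intro k hk x hx
    exact h𝒩.proj_of_ne hx fun e => hg (e ▸ hk)
  · intro x y hx hy
    rw [map_add, hx, hy, add_zero]

theorem IsGrading.coarsen {𝒩 : G → AddSubgroup N} (h𝒩 : IsGrading 𝒩) (φ : G →+ H) :
    IsGrading (coarsen φ 𝒩) where
  indep s y hy h0 h hh := by
    -- Fine components suffice: for `φ g = h`, every other summand of the relation has zero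
    -- component in degree `g`.
    refine h𝒩.eq_zero_of_forall_proj fun g => ?_
    by_cases e : φ g = h
    · have h1 := congrArg (h𝒩.proj g) h0
      rw [map_sum, map_zero, Finset.sum_eq_single_of_mem h hh] at h1
      · exact h1
      · intro k hk hne
        exact h𝒩.proj_of_mem_coarsen (hy k hk) fun e' => hne (e' ▸ e)
    · exact h𝒩.proj_of_mem_coarsen (hy h hh) e
  span := by
    rw [eq_top_iff, ← h𝒩.span]
    exact iSup_le fun g => (le_coarsen φ 𝒩 g).trans (le_iSup (MultiGraded.coarsen φ 𝒩) (φ g))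

end Coarsen

/-! ### Graded free modules -/

section Free

variable {G : Type*} [AddCommGroup G] {A : Type*} [CommRing A] {𝒜 : G → AddSubgroup A}

theorem graded_smul_mem {M : Type*} [AddCommGroup M] [Module A M] {ℳ : G → AddSubgroup M}
    [SetLike.GradedSMul 𝒜 ℳ] {g h k : G} {a : A} {x : M} (ha : a ∈ 𝒜 g) (hx : x ∈ ℳ h)
    (e : g + h = k) : a • x ∈ ℳ k :=
  e ▸ SetLike.GradedSMul.smul_mem ha hx

/-- `proj` of a product with a homogeneous element. -/
theorem IsGrading.proj_smul {M : Type*} [AddCommGroup M] [Module A M] {ℳ : G → AddSubgroup M}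
    [SetLike.GradedSMul 𝒜 ℳ] (h𝒜 : IsGrading 𝒜) (hℳ : IsGrading ℳ) {h : G} (g : G) (a : A) {x : M}
    (hx : x ∈ ℳ h) : hℳ.proj (g + h) (a • x) = h𝒜.proj g a • x :=
  (h𝒜.map_proj hℳ (· + h) (add_left_injective h) ((smulAddHom A M).flip x)
    (fun _ _ ha => graded_smul_mem ha hx rfl) g a).symm

theorem IsGrading.proj_smul' {M : Type*} [AddCommGroup M] [Module A M] {ℳ : G → AddSubgroup M}
    [SetLike.GradedSMul 𝒜 ℳ] (hℳ : IsGrading ℳ) {g : G} (h : G) {a : A} (x : M)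
    (ha : a ∈ 𝒜 g) : hℳ.proj (g + h) (a • x) = a • hℳ.proj h x :=
  (hℳ.map_proj hℳ (g + ·) (add_right_injective g) (DistribSMul.toAddMonoidHom M a)
    (fun _ _ hx => graded_smul_mem ha hx rfl) h x).symm

/-- The grading of the free module on `ι` whose basis element `j` has degree `δ j`. -/
def freeDeg (𝒜 : G → AddSubgroup A) {ι : Type*} (δ : ι → G) (h : G) : AddSubgroup (ι →₀ A) where
  carrier := {f | ∀ s, f s ∈ 𝒜 (h - δ s)}
  zero_mem' := fun _ => zero_mem _
  add_mem' := fun ha hb s => add_mem (ha s) (hb s)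
  neg_mem' := fun ha s => neg_mem (ha s)

theorem single_mem_freeDeg {ι : Type*} (δ : ι → G) {h : G} {j : ι} {a : A}
    (ha : a ∈ 𝒜 (h - δ j)) : Finsupp.single j a ∈ freeDeg 𝒜 δ h := by
  classical
  intro k
  rw [Finsupp.single_apply]
  split_ifs with e
  · exact e ▸ ha
  · exact zero_mem _

theorem single_one_mem_freeDeg [SetLike.GradedMonoid 𝒜] {ι : Type*} (δ : ι → G) (j : ι) :
    Finsupp.single j 1 ∈ freeDeg 𝒜 δ (δ j) := by
  refine single_mem_freeDeg δ ?_
  rw [sub_self]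
  exact SetLike.GradedOne.one_mem

theorem IsGrading.free (h𝒜 : IsGrading 𝒜) {ι : Type*} (δ : ι → G) : IsGrading (freeDeg 𝒜 δ) where
  indep s y hy h0 g hg := by
    ext k
    have h1 := DFunLike.congr_fun h0 k
    rw [Finsupp.finsetSum_apply] at h1
    exact h𝒜.eq_zero_of_sum_eq_zero s (fun g => y g k) (fun g => g - δ k)
      (sub_left_injective) (fun g hg => hy g hg k) h1 g hg
  span := by
    rw [eq_top_iff]
    rintro f -
    induction f using Finsupp.induction_linear with
    | zero => exact zero_mem _
    | add f g hf hg => exact add_mem hf hg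
    | single j a =>
      induction a using h𝒜.induction with
      | mem g a ha =>
        exact AddSubgroup.mem_iSup_of_mem (g + δ j) (single_mem_freeDeg δ (by simpa using ha))
      | zero => simp
      | add a b ha hb =>
        rw [Finsupp.single_add]
        exact add_mem ha hb

variable {M : Type*} [AddCommGroup M] [Module A M] {ℳ : G → AddSubgroup M}

/-- A linear map on a graded free module is homogeneous as soon as it is so on the basis. -/
theorem map_mem_of_basis [SetLike.GradedSMul 𝒜 ℳ] {ι : Type*} {δ : ι → G} {f : (ι →₀ A) →ₗ[A] M}
    {a : G} (hf : ∀ j, f (Finsupp.single j 1) ∈ ℳ (δ j + a)) {g : G} {x : ι →₀ A}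
    (hx : x ∈ freeDeg 𝒜 δ g) : f x ∈ ℳ (g + a) := by
  rw [← Finsupp.sum_single x, Finsupp.sum, map_sum]
  refine sum_mem fun j _ => ?_
  rw [← mul_one (x j), ← smul_eq_mul, ← Finsupp.smul_single, map_smul]
  exact graded_smul_mem (hx j) (hf j) (by abel)

theorem map_mem_of_basis_zero [SetLike.GradedSMul 𝒜 ℳ] {ι : Type*} {δ : ι → G}
    {f : (ι →₀ A) →ₗ[A] M} (hf : ∀ j, f (Finsupp.single j 1) ∈ ℳ (δ j)) {g : G} {x : ι →₀ A}
    (hx : x ∈ freeDeg 𝒜 δ g) : f x ∈ ℳ g := by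
  have := map_mem_of_basis (𝒜 := 𝒜) (a := 0) (fun j => by rw [add_zero]; exact hf j) hx
  rwa [add_zero] at this

instance freeDeg_gradedSMul [SetLike.GradedMonoid 𝒜] {ι : Type*} (δ : ι → G) :
    SetLike.GradedSMul 𝒜 (freeDeg 𝒜 δ) where
  smul_mem g h a x ha hx j := by
    have := SetLike.GradedMul.mul_mem ha (hx j)
    rwa [← add_sub_assoc] at this

/-- The homogeneous component of degree `a` of a linear map on a graded free module. -/
def linearComponent (hℳ : IsGrading ℳ) {ι : Type*} (δ : ι → G) (a : G) (f : (ι →₀ A) →ₗ[A] M) :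
    (ι →₀ A) →ₗ[A] M :=
  Finsupp.linearCombination A fun j => hℳ.proj (δ j + a) (f (Finsupp.single j 1))

theorem linearComponent_single (hℳ : IsGrading ℳ) {ι : Type*} (δ : ι → G) (a : G)
    (f : (ι →₀ A) →ₗ[A] M) (j : ι) : linearComponent hℳ δ a f (Finsupp.single j 1) =
      hℳ.proj (δ j + a) (f (Finsupp.single j 1)) := by
  simp [linearComponent]

theorem linearComponent_apply [SetLike.GradedSMul 𝒜 ℳ] (hℳ : IsGrading ℳ) {ι : Type*} (δ : ι → G)
    (a : G) (f : (ι →₀ A) →ₗ[A] M) {g : G} {x : ι →₀ A} (hx : x ∈ freeDeg 𝒜 δ g) :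
    linearComponent hℳ δ a f x = hℳ.proj (g + a) (f x) := by
  conv_rhs => rw [← Finsupp.sum_single x, Finsupp.sum, map_sum, map_sum]
  rw [linearComponent, Finsupp.linearCombination_apply, Finsupp.sum]
  refine Finset.sum_congr rfl fun j _ => ?_
  rw [← mul_one (x j), ← smul_eq_mul, ← Finsupp.smul_single, map_smul,
    show g + a = (g - δ j) + (δ j + a) by abel, hℳ.proj_smul' _ _ (hx j), smul_eq_mul, mul_one]

/-- Taking components commutes with a differential of degree zero, so components of cocycles are
cocycles and components of coboundaries are coboundaries. -/
theorem linearComponent_comp [SetLike.GradedSMul 𝒜 ℳ] (hℳ : IsGrading ℳ) {ι κ : Type*} (δ : ι → G)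
    (δ' : κ → G) (a : G) (f : (ι →₀ A) →ₗ[A] M) (d : (κ →₀ A) →ₗ[A] (ι →₀ A))
    (hd : ∀ k, d (Finsupp.single k 1) ∈ freeDeg 𝒜 δ (δ' k)) :
    linearComponent hℳ δ a f ∘ₗ d = linearComponent hℳ δ' a (f ∘ₗ d) := by
  refine Finsupp.lhom_ext' fun k => LinearMap.ext_ring ?_
  simp only [LinearMap.comp_apply, Finsupp.lsingle_apply]
  rw [linearComponent_apply hℳ δ a f (hd k), linearComponent_single, LinearMap.comp_apply]

theorem linearComponent_of_homogeneous (hℳ : IsGrading ℳ) {ι : Type*} {δ : ι → G} {a : G}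
    {f : (ι →₀ A) →ₗ[A] M} (hf : ∀ j, f (Finsupp.single j 1) ∈ ℳ (δ j + a)) :
    linearComponent hℳ δ a f = f := by
  refine Finsupp.lhom_ext' fun k => LinearMap.ext_ring ?_
  simp only [LinearMap.comp_apply, Finsupp.lsingle_apply]
  rw [linearComponent_single, hℳ.proj_of_mem (hf k)]

end Free

/-! ### Graded free resolutions -/

/-- Dependent choice, behind the inductive construction of chain maps, homotopies and resolutions.
The type `X n` carries whatever property makes the next step possible. -/
theorem exists_dependent_seq {X : ℕ → Type*} (x₀ : X 0) (r : ∀ n, X n → X (n + 1) → Prop)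
    (h : ∀ n x, ∃ y, r n x y) : ∃ x : ∀ n, X n, x 0 = x₀ ∧ ∀ n, r n (x n) (x (n + 1)) := by
  choose f hf using h
  exact ⟨fun n => Nat.rec x₀ f n, rfl, fun n => hf n _⟩

/-- Projectivity of a free module. The sets `S j` keep track of the degrees of the images of the
basis. -/
theorem finsupp_exists_lift {A ι Q Q' : Type*} [CommRing A] [AddCommGroup Q] [Module A Q]
    [AddCommGroup Q'] [Module A Q'] (d : Q →ₗ[A] Q') (f : (ι →₀ A) →ₗ[A] Q')
    (S : ι → Set Q) (h : ∀ j, ∃ y ∈ S j, d y = f (Finsupp.single j 1)) :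
    ∃ u : (ι →₀ A) →ₗ[A] Q, d ∘ₗ u = f ∧ ∀ j, u (Finsupp.single j 1) ∈ S j := by
  choose y hy hd using h
  refine ⟨Finsupp.linearCombination A y, ?_, fun j => by simpa using hy j⟩
  refine Finsupp.lhom_ext' fun k => LinearMap.ext_ring ?_
  simp [hd]

section Resolution

variable {G : Type*} [AddCommGroup G] {A : Type*} [CommRing A] {N : Type*} [AddCommGroup N]
  [Module A N]

/-- A graded free resolution of a graded module, with chosen homogeneous bases. -/
structure GrRes (𝒜 : G → AddSubgroup A) (𝒩 : G → AddSubgroup N) where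
  ι : ℕ → Type w
  δ : ∀ n, ι n → G
  d : ∀ n, (ι (n + 1) →₀ A) →ₗ[A] (ι n →₀ A)
  ε : (ι 0 →₀ A) →ₗ[A] N
  d_mem : ∀ n j, d n (Finsupp.single j 1) ∈ freeDeg 𝒜 (δ n) (δ (n + 1) j)
  ε_mem : ∀ j, ε (Finsupp.single j 1) ∈ 𝒩 (δ 0 j)
  ε_surj : ∀ g, ∀ x ∈ 𝒩 g, ∃ y ∈ freeDeg 𝒜 (δ 0) g, ε y = x
  exact_zero : Function.Exact (d 0) ε
  exact_succ : ∀ n, Function.Exact (d (n + 1)) (d n)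

namespace GrRes

variable {𝒜 : G → AddSubgroup A} {𝒩 : G → AddSubgroup N}

section Cochain

variable {M : Type*} [AddCommGroup M] [Module A M]

/-- `f` is a coboundary of the (ungraded) complex `Hom(P, M)`. -/
def IsCob (P : GrRes 𝒜 𝒩) : ∀ i : ℕ, ((P.ι i →₀ A) →ₗ[A] M) → Prop
  | 0, f => f = 0
  | i + 1, f => ∃ g : (P.ι i →₀ A) →ₗ[A] M, f = g ∘ₗ P.d i

/-- The cohomology of `Hom(P, M)` in degree `i` has a nonzero class of internal degree `a`. -/
def NonvanishingAt (P : GrRes 𝒜 𝒩) (ℳ : G → AddSubgroup M) (i : ℕ) (a : G) : Prop :=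
  ∃ f : (P.ι i →₀ A) →ₗ[A] M, (∀ j, f (Finsupp.single j 1) ∈ ℳ (P.δ i j + a)) ∧
    f ∘ₗ P.d i = 0 ∧ ¬ P.IsCob i f

theorem IsCob.zero (P : GrRes 𝒜 𝒩) (i : ℕ) : P.IsCob i (0 : (P.ι i →₀ A) →ₗ[A] M) := by
  cases i with
  | zero => rfl
  | succ i => exact ⟨0, by simp⟩

theorem IsCob.add {P : GrRes 𝒜 𝒩} {i : ℕ} {f g : (P.ι i →₀ A) →ₗ[A] M} (hf : P.IsCob i f)
    (hg : P.IsCob i g) : P.IsCob i (f + g) := by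
  cases i with
  | zero =>
    change f + g = 0
    rw [show f = 0 from hf, show g = 0 from hg, add_zero]
  | succ i =>
    obtain ⟨f', rfl⟩ := hf
    obtain ⟨g', rfl⟩ := hg
    exact ⟨f' + g', by rw [LinearMap.add_comp]⟩

theorem IsCob.smul {P : GrRes 𝒜 𝒩} {i : ℕ} {f : (P.ι i →₀ A) →ₗ[A] M} (hf : P.IsCob i f)
    (c : A) : P.IsCob i (c • f) := by
  cases i with
  | zero =>
    change c • f = 0
    rw [show f = 0 from hf, smul_zero]
  | succ i =>
    obtain ⟨f', rfl⟩ := hf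
    exact ⟨c • f', by rw [LinearMap.smul_comp]⟩

end Cochain

/-- The differential is homogeneous, so the component of degree `g` of any preimage is again a
preimage. -/
theorem exists_lift (P : GrRes 𝒜 𝒩) (h𝒜 : IsGrading 𝒜) [SetLike.GradedMonoid 𝒜] (n : ℕ) {g : G}
    {x : P.ι n →₀ A} (hx : x ∈ freeDeg 𝒜 (P.δ n) g) (h : ∃ y, P.d n y = x) :
    ∃ y ∈ freeDeg 𝒜 (P.δ (n + 1)) g, P.d n y = x := by
  obtain ⟨y, rfl⟩ := h
  refine ⟨(h𝒜.free _).proj g y, (h𝒜.free _).proj_mem g y, ?_⟩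
  have := (h𝒜.free (P.δ (n + 1))).map_proj (h𝒜.free (P.δ n)) id Function.injective_id
    (P.d n).toAddMonoidHom (fun g x hx => map_mem_of_basis_zero (P.d_mem n) hx) g y
  exact this.trans ((h𝒜.free _).proj_of_mem hx)

universe w₁ w₂

/-- The identity lifts to a homogeneous chain map between graded free resolutions. -/
theorem exists_chainMap (P : GrRes.{w₁} 𝒜 𝒩) (Q : GrRes.{w₂} 𝒜 𝒩) (h𝒜 : IsGrading 𝒜)
    [SetLike.GradedMonoid 𝒜] :
    ∃ u : ∀ n, (P.ι n →₀ A) →ₗ[A] (Q.ι n →₀ A),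
      (∀ n j, u n (Finsupp.single j 1) ∈ freeDeg 𝒜 (Q.δ n) (P.δ n j)) ∧
      Q.ε ∘ₗ u 0 = P.ε ∧ ∀ n, Q.d n ∘ₗ u (n + 1) = u n ∘ₗ P.d n := by
  obtain ⟨u₀, hu₀, hdeg₀⟩ := finsupp_exists_lift Q.ε P.ε
    (fun j => (freeDeg 𝒜 (Q.δ 0) (P.δ 0 j) : Set (Q.ι 0 →₀ A)))
    fun j => Q.ε_surj _ _ (P.ε_mem j)
  -- The second condition, that `u ∘ d` lands in the image of `Q.d n`, is what the next lift
  -- requires.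
  let X : ℕ → Type _ := fun n => {u : (P.ι n →₀ A) →ₗ[A] (Q.ι n →₀ A) //
    (∀ j, u (Finsupp.single j 1) ∈ freeDeg 𝒜 (Q.δ n) (P.δ n j)) ∧
      ∀ x, ∃ y, Q.d n y = u (P.d n x)}
  let x₀ : X 0 := ⟨u₀, hdeg₀, fun x => (Q.exact_zero _).mp (by
    rw [← LinearMap.comp_apply, hu₀]
    exact P.exact_zero.apply_apply_eq_zero x)⟩
  obtain ⟨u, h0, hu⟩ := exists_dependent_seq x₀
    (fun n (a : X n) (b : X (n + 1)) => Q.d n ∘ₗ b.1 = a.1 ∘ₗ P.d n) (by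
      rintro n ⟨a, ha, ha'⟩
      obtain ⟨b, hb, hdeg⟩ := finsupp_exists_lift (Q.d n) (a ∘ₗ P.d n)
        (fun j => (freeDeg 𝒜 (Q.δ (n + 1)) (P.δ (n + 1) j) : Set (Q.ι (n + 1) →₀ A)))
        fun j => Q.exists_lift h𝒜 n (map_mem_of_basis_zero ha (P.d_mem n j)) (ha' _)
      refine ⟨⟨b, hdeg, fun x => (Q.exact_succ n _).mp ?_⟩, hb⟩
      rw [← LinearMap.comp_apply, hb, LinearMap.comp_apply,
        (P.exact_succ n).apply_apply_eq_zero, map_zero])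
  refine ⟨fun n => (u n).1, fun n => (u n).2.1, ?_, hu⟩
  change Q.ε ∘ₗ (u 0).1 = _
  rw [h0]
  exact hu₀

/-- A chain map lifting zero is null-homotopic. -/
theorem exists_homotopy (P : GrRes.{w₁} 𝒜 𝒩) (Q : GrRes.{w₂} 𝒜 𝒩)
    (u : ∀ n, (P.ι n →₀ A) →ₗ[A] (Q.ι n →₀ A)) (hε : Q.ε ∘ₗ u 0 = 0)
    (hu : ∀ n, Q.d n ∘ₗ u (n + 1) = u n ∘ₗ P.d n) :
    ∃ s : ∀ n, (P.ι n →₀ A) →ₗ[A] (Q.ι (n + 1) →₀ A), Q.d 0 ∘ₗ s 0 = u 0 ∧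
      ∀ n, Q.d (n + 1) ∘ₗ s (n + 1) = u (n + 1) - s n ∘ₗ P.d n := by
  have hu' : ∀ n x, Q.d n (u (n + 1) x) = u n (P.d n x) := fun n x =>
    LinearMap.congr_fun (hu n) x
  -- No degrees are prescribed for the homotopy, because `IsCob` refers to the ungraded complex.
  obtain ⟨s₀, hs₀, -⟩ := finsupp_exists_lift (Q.d 0) (u 0) (fun _ => Set.univ) fun j => by
    obtain ⟨y, hy⟩ := (Q.exact_zero (u 0 (Finsupp.single j 1))).mp (LinearMap.congr_fun hε _)
    exact ⟨y, trivial, hy⟩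
  let X : ℕ → Type _ := fun n => {s : (P.ι n →₀ A) →ₗ[A] (Q.ι (n + 1) →₀ A) //
    ∀ x, ∃ y, Q.d (n + 1) y = u (n + 1) x - s (P.d n x)}
  let x₀ : X 0 := ⟨s₀, fun x => (Q.exact_succ 0 _).mp (by
    rw [map_sub, hu', ← LinearMap.comp_apply (Q.d 0), hs₀, sub_self])⟩
  obtain ⟨s, h0, hs⟩ := exists_dependent_seq x₀
    (fun n (a : X n) (b : X (n + 1)) => Q.d (n + 1) ∘ₗ b.1 = u (n + 1) - a.1 ∘ₗ P.d n) (by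
      rintro n ⟨a, ha⟩
      obtain ⟨b, hb, -⟩ := finsupp_exists_lift (Q.d (n + 1)) (u (n + 1) - a ∘ₗ P.d n)
        (fun _ => Set.univ) fun j => by
          obtain ⟨y, hy⟩ := ha (Finsupp.single j 1)
          exact ⟨y, trivial, hy⟩
      refine ⟨⟨b, fun x => (Q.exact_succ (n + 1) _).mp ?_⟩, hb⟩
      rw [map_sub, hu', ← LinearMap.comp_apply (Q.d (n + 1)), hb, LinearMap.sub_apply,
        LinearMap.comp_apply, (P.exact_succ n).apply_apply_eq_zero, map_zero, sub_zero, sub_self])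
  refine ⟨fun n => (s n).1, ?_, hs⟩
  change Q.d 0 ∘ₗ (s 0).1 = _
  rw [h0]
  exact hs₀

variable {M : Type*} [AddCommGroup M] [Module A M]

/-- With a homotopy `u = d s + s d` and `f d = 0`, only `f u = (f s) d` remains. In degree zero
there is no term `s d`, so `f u = 0`. Independence of the resolution and annihilation of cohomology
both follow from this. -/
theorem isCob_comp_of_lifts_zero {P : GrRes.{w₁} 𝒜 𝒩} {Q : GrRes.{w₂} 𝒜 𝒩}
    {u : ∀ n, (P.ι n →₀ A) →ₗ[A] (Q.ι n →₀ A)} (hε : Q.ε ∘ₗ u 0 = 0)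
    (hu : ∀ n, Q.d n ∘ₗ u (n + 1) = u n ∘ₗ P.d n) {i : ℕ} {f : (Q.ι i →₀ A) →ₗ[A] M}
    (hf : f ∘ₗ Q.d i = 0) : P.IsCob i (f ∘ₗ u i) := by
  obtain ⟨s, hs0, hs⟩ := P.exists_homotopy Q u hε hu
  cases i with
  | zero =>
    change f ∘ₗ u 0 = 0
    rw [← hs0, ← LinearMap.comp_assoc, hf, LinearMap.zero_comp]
  | succ i =>
    refine ⟨f ∘ₗ s i, ?_⟩
    have h1 : f ∘ₗ Q.d (i + 1) ∘ₗ s (i + 1) = 0 := by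
      rw [← LinearMap.comp_assoc, hf, LinearMap.zero_comp]
    rw [hs, LinearMap.comp_sub, sub_eq_zero] at h1
    rw [h1, LinearMap.comp_assoc]

theorem IsCob.comp {P : GrRes.{w₁} 𝒜 𝒩} {Q : GrRes.{w₂} 𝒜 𝒩}
    {u : ∀ n, (P.ι n →₀ A) →ₗ[A] (Q.ι n →₀ A)}
    (hu : ∀ n, Q.d n ∘ₗ u (n + 1) = u n ∘ₗ P.d n) {i : ℕ} {f : (Q.ι i →₀ A) →ₗ[A] M}
    (hf : Q.IsCob i f) : P.IsCob i (f ∘ₗ u i) := by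
  cases i with
  | zero =>
    change f ∘ₗ u 0 = 0
    rw [show f = 0 from hf, LinearMap.zero_comp]
  | succ i =>
    obtain ⟨g, rfl⟩ := hf
    exact ⟨g ∘ₗ u i, by rw [LinearMap.comp_assoc, hu, LinearMap.comp_assoc]⟩

/-- An element annihilating `N` annihilates the cohomology of `Hom(P, M)`. -/
theorem isCob_smul_of_annihilates (P : GrRes 𝒜 𝒩) {c : A} (hc : ∀ x : N, c • x = 0) {i : ℕ}
    {f : (P.ι i →₀ A) →ₗ[A] M} (hf : f ∘ₗ P.d i = 0) : P.IsCob i (c • f) := by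
  have := isCob_comp_of_lifts_zero (P := P) (Q := P) (u := fun n => c • LinearMap.id)
    (LinearMap.ext fun x => by simp [hc]) (fun n => LinearMap.ext fun x => by simp) hf
  rwa [LinearMap.comp_smul, LinearMap.comp_id] at this

/-- Pull `f` back along a homogeneous chain map `u : Q → P`, and let `v : P → Q` be another lift of
the identity. If `f u` were a coboundary, so would be `f u v`. Since `id - u v` lifts zero, `f - f u
v` is a coboundary as well, and hence so would be `f`. -/
theorem NonvanishingAt.of_resolution {P : GrRes.{w₁} 𝒜 𝒩} {ℳ : G → AddSubgroup M}
    [SetLike.GradedMonoid 𝒜] [SetLike.GradedSMul 𝒜 ℳ] {i : ℕ} {a : G}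
    (h : P.NonvanishingAt ℳ i a) (h𝒜 : IsGrading 𝒜) (Q : GrRes.{w₂} 𝒜 𝒩) :
    Q.NonvanishingAt ℳ i a := by
  obtain ⟨f, hdeg, hf, hcob⟩ := h
  obtain ⟨u, hudeg, hu0, hu⟩ := Q.exists_chainMap P h𝒜
  obtain ⟨v, -, hv0, hv⟩ := P.exists_chainMap Q h𝒜
  refine ⟨f ∘ₗ u i, fun j => map_mem_of_basis hdeg (hudeg i j), ?_, fun hc => hcob ?_⟩
  · rw [LinearMap.comp_assoc, ← hu, ← LinearMap.comp_assoc, hf, LinearMap.zero_comp]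
  · have h1 := hc.comp (P := P) hv
    have h2 := isCob_comp_of_lifts_zero (P := P) (Q := P)
      (u := fun n => LinearMap.id - u n ∘ₗ v n)
      (by rw [LinearMap.comp_sub, ← LinearMap.comp_assoc, hu0, hv0, LinearMap.comp_id, sub_self])
      (fun n => by
        rw [LinearMap.comp_sub, LinearMap.sub_comp, ← LinearMap.comp_assoc, hu,
          LinearMap.comp_assoc, hv, LinearMap.comp_assoc, LinearMap.comp_id, LinearMap.id_comp]) hf
    have h3 := h1.add h2
    rwa [LinearMap.comp_assoc, ← LinearMap.comp_add, add_sub_cancel (u i ∘ₗ v i),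
      LinearMap.comp_id] at h3

theorem nonvanishingAt_iff (P : GrRes.{w₁} 𝒜 𝒩) (Q : GrRes.{w₂} 𝒜 𝒩) {ℳ : G → AddSubgroup M}
    [SetLike.GradedMonoid 𝒜] [SetLike.GradedSMul 𝒜 ℳ] {i : ℕ} {a : G} (h𝒜 : IsGrading 𝒜) :
    P.NonvanishingAt ℳ i a ↔ Q.NonvanishingAt ℳ i a :=
  ⟨fun h => h.of_resolution h𝒜 Q, fun h => h.of_resolution h𝒜 P⟩

end GrRes

end Resolution

/-! ### The canonical resolution computes `*Ext` -/

section Canonical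

variable {G : Type} [AddCommGroup G] {A : Type u} [CommRing A] {𝒜 : G → AddSubgroup A}

theorem coverMap_single (N : GrMod A G) (s : Σ g : G, N.deg g) :
    coverMap 𝒜 N (Finsupp.single s (1 : A)) = s.2 :=
  (Finsupp.linearCombination_single A (1 : A) s).trans (one_smul _ _)

theorem coverMap_mem (N : GrMod A G) [SetLike.GradedSMul 𝒜 N.deg] {g : G}
    {x : (freeCover 𝒜 N).carrier} (hx : x ∈ (freeCover 𝒜 N).deg g) :
    coverMap 𝒜 N x ∈ N.deg g :=
  map_mem_of_basis_zero (𝒜 := 𝒜) (f := coverMap 𝒜 N) (δ := Sigma.fst)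
    (fun j => (coverMap_single (𝒜 := 𝒜) N j).symm ▸ j.2.2) hx

theorem coverMap_surjective (N : GrMod A G) (hN : ⨆ g, N.deg g = ⊤) :
    Function.Surjective (coverMap 𝒜 N) := by
  have : ⨆ g, N.deg g ≤ (coverMap 𝒜 N).toAddMonoidHom.range :=
    iSup_le fun g x hx => ⟨Finsupp.single ⟨g, x, hx⟩ (1 : A), coverMap_single (𝒜 := 𝒜) N _⟩
  intro x
  exact this (hN ▸ AddSubgroup.mem_top x)

theorem syzygy_isGrading (h𝒜 : IsGrading 𝒜) {N : GrMod A G} [SetLike.GradedSMul 𝒜 N.deg]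
    (hN : IsGrading N.deg) : IsGrading (syzygy 𝒜 N).deg where
  indep s y hy h0 g hg := by
    have h1 := (h𝒜.free Sigma.fst).indep s
      (fun g => (LinearMap.ker (coverMap 𝒜 N)).subtype (y g)) (fun g hg => hy g hg)
      (by
        refine (map_sum (LinearMap.ker (coverMap 𝒜 N)).subtype y s).symm.trans ?_
        exact congrArg (LinearMap.ker (coverMap 𝒜 N)).subtype h0) g hg
    exact Subtype.ext h1
  span := by
    rw [eq_top_iff]
    rintro ⟨x, hx⟩ -
    have h1 := (h𝒜.free Sigma.fst).ker_le_iSup hN (coverMap 𝒜 N).toAddMonoidHom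
      (fun g x hx => coverMap_mem N hx) hx
    suffices h : ∀ x ∈ ⨆ g, freeDeg 𝒜 (Sigma.fst : (Σ g : G, N.deg g) → G) g ⊓
        (coverMap 𝒜 N).toAddMonoidHom.ker, ∃ z ∈ ⨆ g, (syzygy 𝒜 N).deg g,
        (LinearMap.ker (coverMap 𝒜 N)).subtype z = x by
      obtain ⟨z, hz, e⟩ := h x h1
      rwa [show z = ⟨x, hx⟩ from Subtype.ext e] at hz
    intro x hx
    refine AddSubgroup.iSup_induction (C := fun x => ∃ z ∈ ⨆ g, (syzygy 𝒜 N).deg g,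
        (LinearMap.ker (coverMap 𝒜 N)).subtype z = x) _ hx ?_ ?_ ?_
    · rintro g x ⟨hx, hx'⟩
      exact ⟨⟨x, hx'⟩, AddSubgroup.mem_iSup_of_mem g hx, rfl⟩
    · exact ⟨0, zero_mem _, map_zero _⟩
    · rintro _ _ ⟨z, hz, rfl⟩ ⟨z', hz', rfl⟩
      exact ⟨z + z', add_mem hz hz', map_add _ _ _⟩

variable [SetLike.GradedMonoid 𝒜]

theorem syzygy_gradedSMul (N : GrMod A G) : SetLike.GradedSMul 𝒜 (syzygy 𝒜 N).deg where
  smul_mem _ _ _ _ ha hx :=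
    (freeDeg_gradedSMul (𝒜 := 𝒜) (Sigma.fst : (Σ g : G, N.deg g) → G)).smul_mem ha hx

theorem iterSyzygy_graded (h𝒜 : IsGrading 𝒜) (N : GrMod A G) [hs : SetLike.GradedSMul 𝒜 N.deg]
    (hN : IsGrading N.deg) (n : ℕ) : SetLike.GradedSMul 𝒜 (iterSyzygy 𝒜 N n).deg ∧
      IsGrading (iterSyzygy 𝒜 N n).deg := by
  induction n with
  | zero => exact ⟨hs, hN⟩
  | succ n ih =>
    have := ih.1
    exact ⟨syzygy_gradedSMul _, syzygy_isGrading h𝒜 ih.2⟩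

theorem exact_syzygyIncl_coverMap (h𝒜 : IsGrading 𝒜) (N : GrMod A G)
    [SetLike.GradedSMul 𝒜 N.deg] (hN : IsGrading N.deg) (n : ℕ) :
    Function.Exact (resDiff 𝒜 N n) (coverMap 𝒜 (iterSyzygy 𝒜 N n)) := by
  intro x
  constructor
  · intro hx
    obtain ⟨y, hy⟩ := coverMap_surjective (𝒜 := 𝒜) (iterSyzygy 𝒜 N (n + 1))
      (iterSyzygy_graded h𝒜 N hN (n + 1)).2.span ⟨x, hx⟩
    exact ⟨y, congrArg Subtype.val hy⟩
  · rintro ⟨y, rfl⟩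
    exact (coverMap 𝒜 (iterSyzygy 𝒜 N (n + 1)) y).2

/-- The canonical graded free resolution. -/
def canonicalRes (h𝒜 : IsGrading 𝒜) (N : GrMod A G) [SetLike.GradedSMul 𝒜 N.deg]
    (hN : IsGrading N.deg) : GrRes.{u} 𝒜 N.deg where
  ι n := Σ g : G, (iterSyzygy 𝒜 N n).deg g
  δ _ := Sigma.fst
  d n := resDiff 𝒜 N n
  ε := coverMap 𝒜 N
  d_mem n j := by
    have h : coverMap 𝒜 (iterSyzygy 𝒜 N (n + 1)) (Finsupp.single j (1 : A)) ∈
        (iterSyzygy 𝒜 N (n + 1)).deg j.1 := (coverMap_single (𝒜 := 𝒜) _ j).symm ▸ j.2.2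
    exact h
  ε_mem j := by
    have h : coverMap 𝒜 N (Finsupp.single j (1 : A)) ∈ N.deg j.1 :=
      (coverMap_single (𝒜 := 𝒜) N j).symm ▸ j.2.2
    exact h
  ε_surj g x hx := ⟨Finsupp.single ⟨g, x, hx⟩ (1 : A),
    single_one_mem_freeDeg (𝒜 := 𝒜) 
      (Sigma.fst : (Σ g : G, N.deg g) → G) ⟨g, x, hx⟩, coverMap_single (𝒜 := 𝒜) N _⟩
  exact_zero := exact_syzygyIncl_coverMap h𝒜 N hN 0
  exact_succ n := by
    intro x
    refine Iff.trans ?_ (exact_syzygyIncl_coverMap h𝒜 N hN (n + 1) x)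
    exact map_eq_zero_iff (syzygyIncl 𝒜 N n) Subtype.val_injective

theorem mem_starHomDeg_iff {M : Type v} [AddCommGroup M] [Module A M] {ℳ : G → AddSubgroup M}
    [SetLike.GradedSMul 𝒜 ℳ] (N : GrMod A G) (a : G)
    (f : (freeCover 𝒜 N).carrier →ₗ[A] M) : f ∈ starHomDeg ℳ (freeCover 𝒜 N) a ↔
      ∀ j : (Σ g : G, N.deg g), f (Finsupp.single j (1 : A)) ∈ ℳ (j.1 + a) :=
  ⟨fun h j => h _ _ (single_one_mem_freeDeg (𝒜 := 𝒜) (Sigma.fst : (Σ g : G, N.deg g) → G) j),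
    fun h _ _ hx => map_mem_of_basis (𝒜 := 𝒜) (δ := (Sigma.fst : (Σ g : G, N.deg g) → G)) h hx⟩

/-- The graded and the ungraded Hom complex have the same coboundaries of degree `a`: if `f = g ∘ d`
is homogeneous of degree `a`, then `g` may be replaced by its component of degree `a`. -/
theorem starExtDeg_ne_bot_iff {M : Type v} [AddCommGroup M] [Module A M] {ℳ : G → AddSubgroup M}
    [SetLike.GradedSMul 𝒜 ℳ] (h𝒜 : IsGrading 𝒜) (hℳ : IsGrading ℳ) (N : GrMod A G)
    [SetLike.GradedSMul 𝒜 N.deg] (hN : IsGrading N.deg) (i : ℕ) (a : G) :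
    starExtDeg 𝒜 ℳ N i a ≠ ⊥ ↔ (canonicalRes h𝒜 N hN).NonvanishingAt ℳ i a := by
  have key : ∀ f : (resTerm 𝒜 N i).carrier →ₗ[A] M, f ∈ starHomDeg ℳ (resTerm 𝒜 N i) a →
      (f ∈ coboundaries 𝒜 ℳ N i ↔ (canonicalRes h𝒜 N hN).IsCob i f) := by
    intro f hf
    cases i with
    | zero => exact AddSubgroup.mem_bot
    | succ i =>
      constructor
      · rintro ⟨g, -, rfl⟩
        exact ⟨g, rfl⟩
      · rintro ⟨g, rfl⟩
        have hf' := (mem_starHomDeg_iff (𝒜 := 𝒜) (ℳ := ℳ) _ _ _).mp hf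
        have h1 := linearComponent_comp hℳ ((canonicalRes h𝒜 N hN).δ i)
          ((canonicalRes h𝒜 N hN).δ (i + 1)) a g _ ((canonicalRes h𝒜 N hN).d_mem i)
        have h2 := h1.trans (linearComponent_of_homogeneous hℳ hf')
        refine ⟨linearComponent hℳ ((canonicalRes h𝒜 N hN).δ i) a g, ?_, h2⟩
        refine AddSubgroup.mem_iSup_of_mem a ((mem_starHomDeg_iff _ _ _).mpr fun j => ?_)
        have h3 := linearComponent_single hℳ ((canonicalRes h𝒜 N hN).δ i) a g j
        exact h3 ▸ hℳ.proj_mem _ _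
  rw [Ne, starExtDeg, AddSubgroup.eq_bot_iff_forall, not_forall]
  constructor
  · rintro ⟨x, hx⟩
    rw [Classical.not_imp] at hx
    obtain ⟨⟨⟨f, hf⟩, hdeg, rfl⟩, hne⟩ := hx
    have hdeg' : f ∈ starHomDeg ℳ (resTerm 𝒜 N i) a := hdeg
    refine ⟨f, (mem_starHomDeg_iff _ _ _).mp hdeg', hf.2, fun hc => hne ?_⟩
    exact (QuotientAddGroup.eq_zero_iff _).mpr ((key f hdeg').mpr hc)
  · rintro ⟨f, hdeg, hf, hc⟩
    have hdeg' : f ∈ starHomDeg ℳ (resTerm 𝒜 N i) a := (mem_starHomDeg_iff _ _ _).mpr hdeg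
    refine ⟨QuotientAddGroup.mk' _ ⟨f, AddSubgroup.mem_iSup_of_mem a hdeg', hf⟩, fun h => ?_⟩
    have h0 := h ⟨_, hdeg', rfl⟩
    exact hc ((key f hdeg').mp ((QuotientAddGroup.eq_zero_iff
      (N := (coboundaries 𝒜 ℳ N i).addSubgroupOf (cocycles 𝒜 ℳ N i)) _).mp h0))

end Canonical

/-! ### Finite graded free resolutions over Noetherian rings -/

section FiniteResolution

variable {G : Type*} {A : Type*} [CommRing A]

/-- The homogeneous elements of `K` span it, and a spanning set of a finitely generated module
contains a finite spanning subset. -/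
theorem exists_homogeneous_generators {F : Type*} [AddCommGroup F] [Module A F]
    (ℱ : G → AddSubgroup F) {K : Submodule A F} (hfg : K.FG)
    (hK : K.toAddSubgroup ≤ ⨆ g, ℱ g ⊓ K.toAddSubgroup) :
    ∃ (k : ℕ) (x : Fin k → F) (δ : Fin k → G), (∀ j, x j ∈ ℱ (δ j)) ∧
      Submodule.span A (Set.range x) = K := by
  set X : Set F := {x | x ∈ K ∧ ∃ g, x ∈ ℱ g} with hX
  have hspan : Submodule.span A X = K := by
    refine le_antisymm (Submodule.span_le.mpr fun x hx => hx.1) ?_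
    have h1 : ⨆ g, ℱ g ⊓ K.toAddSubgroup ≤ (Submodule.span A X).toAddSubgroup :=
      iSup_le fun g x hx => Submodule.subset_span ⟨hx.2, g, hx.1⟩
    exact fun x hx => h1 (hK hx)
  rw [← hspan, Submodule.fg_span_iff_fg_span_finset_subset] at hfg
  obtain ⟨s, hs, he⟩ := hfg
  have hdeg : ∀ j : Fin s.card, ∃ g, (s.equivFin.symm j : F) ∈ ℱ g := fun j =>
    (hs (s.equivFin.symm j).2).2
  choose δ hδ using hdeg
  refine ⟨s.card, fun j => s.equivFin.symm j, δ, hδ, ?_⟩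
  rw [← hspan, he]
  congr 1
  ext x
  constructor
  · rintro ⟨j, rfl⟩
    exact (s.equivFin.symm j).2
  · intro hx
    exact ⟨s.equivFin ⟨x, hx⟩, by simp⟩

/-- The grading of a quotient ring. -/
abbrev quotDeg (𝒜 : G → AddSubgroup A) (I : Ideal A) (g : G) : AddSubgroup (A ⧸ I) :=
  (𝒜 g).map (Ideal.Quotient.mk I).toAddMonoidHom

theorem quotDeg_isGrading {𝒜 : G → AddSubgroup A} (h𝒜 : IsGrading 𝒜) {I : Ideal A}
    (hI : Submodule.toAddSubgroup I ≤ ⨆ g, 𝒜 g ⊓ Submodule.toAddSubgroup I) :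
    IsGrading (quotDeg 𝒜 I) := by
  have hker : (Ideal.Quotient.mk I).toAddMonoidHom.ker = Submodule.toAddSubgroup I := by
    ext x
    exact Ideal.Quotient.eq_zero_iff_mem
  exact h𝒜.map_of_ker_le_iSup _ Ideal.Quotient.mk_surjective (by rw [hker]; exact hI)

variable [AddCommGroup G]

/-- A graded free module of finite rank together with a graded submodule. -/
structure FreeStage (𝒜 : G → AddSubgroup A) where
  rank : ℕ
  δ : Fin rank → G
  K : Submodule A (Fin rank →₀ A)
  graded : K.toAddSubgroup ≤ ⨆ g, freeDeg 𝒜 δ g ⊓ K.toAddSubgroup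

variable {𝒜 : G → AddSubgroup A} [SetLike.GradedMonoid 𝒜]

theorem FreeStage.exists_next [IsNoetherianRing A] (h𝒜 : IsGrading 𝒜) (S : FreeStage 𝒜) :
    ∃ (S' : FreeStage 𝒜) (d : (Fin S'.rank →₀ A) →ₗ[A] (Fin S.rank →₀ A)),
      (∀ j, d (Finsupp.single j 1) ∈ freeDeg 𝒜 S.δ (S'.δ j)) ∧
      LinearMap.range d = S.K ∧ LinearMap.ker d = S'.K := by
  obtain ⟨k, x, δ, hx, hspan⟩ := exists_homogeneous_generators (freeDeg 𝒜 S.δ)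
    (IsNoetherian.noetherian S.K) S.graded
  have hd : ∀ j, Finsupp.linearCombination A x (Finsupp.single j 1) ∈ freeDeg 𝒜 S.δ (δ j) :=
    fun j => by simpa using hx j
  refine ⟨⟨k, δ, LinearMap.ker (Finsupp.linearCombination A x), ?_⟩,
    Finsupp.linearCombination A x, hd, ?_, rfl⟩
  · exact (h𝒜.free δ).ker_le_iSup (h𝒜.free S.δ) (Finsupp.linearCombination A x).toAddMonoidHom
      fun g y hy => map_mem_of_basis_zero hd hy
  · rw [Finsupp.range_linearCombination, hspan]

instance quotDeg_gradedSMul (I : Ideal A) : SetLike.GradedSMul 𝒜 (quotDeg 𝒜 I) where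
  smul_mem := by
    rintro g h a _ ha ⟨x, hx, rfl⟩
    exact ⟨a * x, SetLike.GradedMul.mul_mem ha hx, rfl⟩

theorem exists_finite_resolution [IsNoetherianRing A] (h𝒜 : IsGrading 𝒜) {I : Ideal A}
    (hI : Submodule.toAddSubgroup I ≤ ⨆ g, 𝒜 g ⊓ Submodule.toAddSubgroup I) :
    ∃ P : GrRes.{0} 𝒜 (quotDeg 𝒜 I), ∀ n, Finite (P.ι n) := by
  let ε₀ : (Fin 1 →₀ A) →ₗ[A] A ⧸ I :=
    Finsupp.linearCombination A fun _ => Ideal.Quotient.mk I 1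
  have hε₀ : ∀ j, ε₀ (Finsupp.single j 1) ∈ quotDeg 𝒜 I 0 := fun j =>
    ⟨1, SetLike.GradedOne.one_mem, by simp [ε₀]⟩
  let S₀ : FreeStage 𝒜 := ⟨1, 0, LinearMap.ker ε₀,
    (h𝒜.free 0).ker_le_iSup (quotDeg_isGrading h𝒜 hI) ε₀.toAddMonoidHom
      fun g y hy => map_mem_of_basis_zero (𝒜 := 𝒜) hε₀ hy⟩
  -- The augmentation is formulated for an arbitrary stage so that it can be transported along `S 0
  -- = S₀`.
  let Aug : FreeStage 𝒜 → Prop := fun S => ∃ ε : (Fin S.rank →₀ A) →ₗ[A] A ⧸ I,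
    (∀ j, ε (Finsupp.single j 1) ∈ quotDeg 𝒜 I (S.δ j)) ∧
    (∀ g, ∀ x ∈ quotDeg 𝒜 I g, ∃ y ∈ freeDeg 𝒜 S.δ g, ε y = x) ∧ LinearMap.ker ε = S.K
  have hAug : Aug S₀ := by
    refine ⟨ε₀, hε₀, ?_, rfl⟩
    rintro g _ ⟨a, ha, rfl⟩
    refine ⟨Finsupp.single 0 a, single_mem_freeDeg _ (by simpa [S₀] using ha), ?_⟩
    simp only [ε₀, Finsupp.linearCombination_single]
    rw [Algebra.smul_def, map_one, mul_one]
    rfl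
  obtain ⟨S, h0, hS⟩ := exists_dependent_seq (X := fun _ => FreeStage 𝒜) S₀
    (fun _ S S' => ∃ d : (Fin S'.rank →₀ A) →ₗ[A] (Fin S.rank →₀ A),
      (∀ j, d (Finsupp.single j 1) ∈ freeDeg 𝒜 S.δ (S'.δ j)) ∧
      LinearMap.range d = S.K ∧ LinearMap.ker d = S'.K) fun _ S => S.exists_next h𝒜
  rw [← h0] at hAug
  obtain ⟨ε, hε, hsurj, hker⟩ := hAug
  choose d hdeg hrange hkerd using hS
  exact ⟨{ ι := fun n => Fin (S n).rank
           δ := fun n => (S n).δ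
           d := d
           ε := ε
           d_mem := hdeg
           ε_mem := hε
           ε_surj := hsurj
           exact_zero := LinearMap.exact_iff.mpr (by rw [hker, hrange])
           exact_succ := fun n => LinearMap.exact_iff.mpr (by rw [hkerd, hrange]) },
    fun n => (inferInstance : Finite (Fin (S n).rank))⟩

end FiniteResolution

/-! ### Localization of gradings and of linear maps between free modules -/

section Localize

section Grading

variable {G : Type*} [AddCommGroup G] {R : Type*} [CommRing R] {𝒜 : G → AddSubgroup R}
  [SetLike.GradedMonoid 𝒜] {S : Submonoid R} {M M' : Type*} [AddCommGroup M] [Module R M]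
  [AddCommGroup M'] [Module R M'] {ℳ : G → AddSubgroup M} {ℳ' : G → AddSubgroup M'}
  [SetLike.GradedSMul 𝒜 ℳ]

/-- Membership in the graded pieces of a localized module. -/
def IsLocGrading (𝒜 : G → AddSubgroup R) (S : Submonoid R) (ℳ : G → AddSubgroup M)
    (ℳ' : G → AddSubgroup M') (l : M →ₗ[R] M') : Prop :=
  ∀ g z, z ∈ ℳ' g ↔ ∃ (d : G) (s : S) (x : M), (s : R) ∈ 𝒜 d ∧ x ∈ ℳ (g + d) ∧ s • z = l x

/-- Finitely many homogeneous fractions have a common homogeneous denominator. -/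
theorem IsLocGrading.exists_common_denominator {l : M →ₗ[R] M'}
    (h : IsLocGrading 𝒜 S ℳ ℳ' l) {ι : Type*} (F : Finset ι) (z : ι → M') (σ : ι → G)
    (hz : ∀ i ∈ F, z i ∈ ℳ' (σ i)) :
    ∃ (d : G) (s : S), (s : R) ∈ 𝒜 d ∧ ∀ i ∈ F, ∃ y ∈ ℳ (σ i + d), s • z i = l y := by
  classical
  induction F using Finset.induction_on with
  | empty => exact ⟨0, 1, SetLike.GradedOne.one_mem, by simp⟩
  | insert i F hi ih =>
    obtain ⟨d, s, hs, hF⟩ := ih fun j hj => hz j (Finset.mem_insert_of_mem hj)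
    obtain ⟨e, t, x, ht, hx, htz⟩ := (h _ _).mp (hz i (Finset.mem_insert_self i F))
    refine ⟨d + e, s * t, SetLike.GradedMul.mul_mem hs ht, fun j hj => ?_⟩
    rcases Finset.mem_insert.mp hj with rfl | hj
    · refine ⟨(s : R) • x, graded_smul_mem hs hx (by abel), ?_⟩
      rw [mul_smul, htz, map_smul]
      rfl
    · obtain ⟨y, hy, hsy⟩ := hF j hj
      refine ⟨(t : R) • y, graded_smul_mem ht hy (by abel), ?_⟩
      rw [mul_comm, mul_smul, hsy, map_smul]
      rfl

/-- A relation between fractions becomes one in `M` after clearing a common homogeneous denominator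
and multiplying by a further homogeneous `t`. Both multiplications shift all degrees by the same
amount, so distinct degrees stay distinct. -/
theorem IsLocGrading.isGrading {l : M →ₗ[R] M'} (h : IsLocGrading 𝒜 S ℳ ℳ' l)
    (hℳ : IsGrading ℳ) (hS : ∀ s : S, ∃ d, (s : R) ∈ 𝒜 d) [IsLocalizedModule S l] :
    IsGrading ℳ' where
  indep F z hz h0 := by
    obtain ⟨d, s, hs, hF⟩ := h.exists_common_denominator F z id hz
    choose! y hy hsy using hF
    have h1 : l (∑ g ∈ F, y g) = 0 := by
      rw [map_sum, ← smul_zero s, ← h0, Finset.smul_sum]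
      exact Finset.sum_congr rfl fun g hg => (hsy g hg).symm
    obtain ⟨t, ht⟩ := (IsLocalizedModule.eq_zero_iff S l).mp h1
    obtain ⟨e, hte⟩ := hS t
    have h2 := hℳ.eq_zero_of_sum_eq_zero F (fun g => (t : R) • y g) (fun g => e + (g + d))
      (fun a b hab => add_right_cancel (add_left_cancel hab))
      (fun g hg => graded_smul_mem hte (hy g hg) rfl) (by rw [← Finset.smul_sum]; exact ht)
    intro g hg
    apply IsLocalizedModule.smul_injective l s
    change s • z g = s • 0
    rw [hsy g hg, smul_zero, IsLocalizedModule.eq_zero_iff S l]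
    exact ⟨t, h2 g hg⟩
  span := by
    rw [eq_top_iff]
    rintro z -
    obtain ⟨⟨x, s⟩, hx⟩ := IsLocalizedModule.surj S l z
    obtain ⟨d, hd⟩ := hS s
    have hz : z = IsLocalizedModule.mk' l x s :=
      (IsLocalizedModule.mk'_eq_iff.mpr hx.symm).symm
    rw [hz]
    clear hz hx
    induction x using hℳ.induction with
    | mem g x hx =>
      refine AddSubgroup.mem_iSup_of_mem (g - d) ((h _ _).mpr ⟨d, s, x, hd, ?_, ?_⟩)
      · rwa [sub_add_cancel]
      · exact IsLocalizedModule.mk'_cancel' l x s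
    | zero => rw [IsLocalizedModule.mk'_zero]; exact zero_mem _
    | add x y hx hy => rw [IsLocalizedModule.mk'_add]; exact add_mem hx hy

end Grading

section Maps

variable {R : Type*} [CommRing R] {S : Submonoid R} (B : Type*) [CommRing B] [Algebra R B]

/-- The localization map of a free module. -/
abbrev freeLoc (R : Type*) [CommRing R] (B : Type*) [CommRing B] [Algebra R B] (ι : Type*) :
    (ι →₀ R) →ₗ[R] (ι →₀ B) :=
  Finsupp.mapRange.linearMap (Algebra.linearMap R B)

/-- The base change of a linear map from a free module. -/
def baseChangeMap {R : Type*} [CommRing R] (B : Type*) [CommRing B] [Algebra R B] {ι Y Y' : Type*}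
    [AddCommGroup Y] [Module R Y] [AddCommGroup Y'] [Module R Y'] [Module B Y']
    (l : Y →ₗ[R] Y') (f : (ι →₀ R) →ₗ[R] Y) : (ι →₀ B) →ₗ[B] Y' :=
  Finsupp.linearCombination B fun j => l (f (Finsupp.single j 1))

variable {Y Y' : Type*} [AddCommGroup Y] [Module R Y] [AddCommGroup Y'] [Module R Y'] [Module B Y']
  {ι κ : Type*}

theorem finsupp_hom_ext_single {B Y' : Type*} [CommRing B] [AddCommGroup Y'] [Module B Y']
    {f g : (ι →₀ B) →ₗ[B] Y'}
    (h : ∀ j, f (Finsupp.single j 1) = g (Finsupp.single j 1)) : f = g :=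
  Finsupp.lhom_ext' fun j => LinearMap.ext_ring (h j)

theorem freeLoc_single_one (j : ι) :
    freeLoc R B ι (Finsupp.single j 1) = Finsupp.single j 1 := by
  simp

theorem baseChangeMap_single (l : Y →ₗ[R] Y') (f : (ι →₀ R) →ₗ[R] Y) (j : ι) :
    baseChangeMap B l f (Finsupp.single j 1) = l (f (Finsupp.single j 1)) := by
  simp [baseChangeMap]

variable {B}

variable (S) in
/-- `f'` is the fraction `f / s`. -/
def IsFraction (l : Y →ₗ[R] Y') (s : S) (f : (ι →₀ R) →ₗ[R] Y) (f' : (ι →₀ B) →ₗ[B] Y') : Prop :=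
  ∀ x, s • f' (freeLoc R B ι x) = l (f x)

theorem IsFraction.smul {l : Y →ₗ[R] Y'} {s : S} {f : (ι →₀ R) →ₗ[R] Y}
    {f' : (ι →₀ B) →ₗ[B] Y'} (h : IsFraction S l s f f') (t : S) :
    IsFraction S l (t * s) (t • f) f' := fun x => by
  rw [mul_smul, h x]
  exact (map_smul l (t : R) (f x)).symm

theorem isFraction_iff [IsScalarTower R B Y'] {l : Y →ₗ[R] Y'} {s : S} {f : (ι →₀ R) →ₗ[R] Y}
    {f' : (ι →₀ B) →ₗ[B] Y'} : IsFraction S l s f f' ↔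
      ∀ j, s • f' (Finsupp.single j 1) = l (f (Finsupp.single j 1)) := by
  constructor
  · intro h j
    rw [← freeLoc_single_one (R := R), h]
  · intro h
    have : (s : R) • (f'.restrictScalars R ∘ₗ freeLoc R B ι) = l ∘ₗ f :=
      finsupp_hom_ext_single fun j => by
        rw [LinearMap.smul_apply, LinearMap.comp_apply, freeLoc_single_one]
        exact h j
    exact fun x => LinearMap.congr_fun this x

theorem isFraction_baseChangeMap [IsScalarTower R B Y'] (l : Y →ₗ[R] Y') (f : (ι →₀ R) →ₗ[R] Y) :
    IsFraction S l 1 f (baseChangeMap B l f) :=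
  isFraction_iff.mpr fun j => by rw [baseChangeMap_single, one_smul]

theorem baseChangeMap_freeLoc [IsScalarTower R B Y'] (l : Y →ₗ[R] Y') (f : (ι →₀ R) →ₗ[R] Y)
    (x : ι →₀ R) : baseChangeMap B l f (freeLoc R B ι x) = l (f x) := by
  have := isFraction_baseChangeMap (S := (⊥ : Submonoid R)) (B := B) l f x
  rwa [one_smul] at this

theorem IsFraction.comp {l : Y →ₗ[R] Y'} {s : S} {f : (ι →₀ R) →ₗ[R] Y}
    {f' : (ι →₀ B) →ₗ[B] Y'} (h : IsFraction S l s f f') (d : (κ →₀ R) →ₗ[R] (ι →₀ R)) :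
    IsFraction S l s (f ∘ₗ d) (f' ∘ₗ baseChangeMap B (freeLoc R B ι) d) := fun x => by
  rw [LinearMap.comp_apply, baseChangeMap_freeLoc, h, LinearMap.comp_apply]

variable [IsScalarTower R B Y'] (l : Y →ₗ[R] Y') [IsLocalizedModule S l]

theorem exists_isFraction_of_base (s : S) (f : (ι →₀ R) →ₗ[R] Y) :
    ∃ f' : (ι →₀ B) →ₗ[B] Y', IsFraction S l s f f' :=
  ⟨Finsupp.linearCombination B fun j => IsLocalizedModule.mk' l (f (Finsupp.single j 1)) s,
    isFraction_iff.mpr fun j => by simp⟩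

theorem exists_isFraction [Finite ι] (f' : (ι →₀ B) →ₗ[B] Y') :
    ∃ (s : S) (f : (ι →₀ R) →ₗ[R] Y), IsFraction S l s f f' := by
  obtain ⟨s, hs⟩ := IsLocalizedModule.exist_integer_multiples_of_finite S l
    fun j : ι => f' (Finsupp.single j 1)
  choose y hy using hs
  refine ⟨s, Finsupp.linearCombination R y, isFraction_iff.mpr fun j => ?_⟩
  rw [Finsupp.linearCombination_single, one_smul]
  exact (hy j).symm

theorem IsFraction.eq_zero {l : Y →ₗ[R] Y'} [IsLocalizedModule S l] {s : S}
    {f' : (ι →₀ B) →ₗ[B] Y'} (h : IsFraction S l s (0 : (ι →₀ R) →ₗ[R] Y) f') : f' = 0 := by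
  refine finsupp_hom_ext_single fun j => IsLocalizedModule.smul_injective l s ?_
  change s • _ = s • _
  rw [isFraction_iff.mp h j]
  simp

theorem IsFraction.exists_smul_eq_zero {l : Y →ₗ[R] Y'} [IsLocalizedModule S l] [Finite ι] {s : S}
    {f : (ι →₀ R) →ₗ[R] Y} (h : IsFraction S l s f (0 : (ι →₀ B) →ₗ[B] Y')) :
    ∃ t : S, t • f = 0 := by
  classical
  have h1 : ∀ j, ∃ t : S, t • f (Finsupp.single j 1) = 0 := fun j => by
    rw [← IsLocalizedModule.eq_zero_iff S l, ← isFraction_iff.mp h j]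
    simp
  choose t ht using h1
  have := Fintype.ofFinite ι
  refine ⟨∏ j, t j, finsupp_hom_ext_single fun j => ?_⟩
  rw [LinearMap.smul_apply, ← Finset.prod_erase_mul _ _ (Finset.mem_univ j), mul_smul, ht,
    smul_zero, LinearMap.zero_apply]

/-- A coboundary becomes one after localization, and conversely after clearing denominators. -/
theorem IsFraction.exists_comp_iff {l : Y →ₗ[R] Y'} [IsLocalizedModule S l] [Finite ι] [Finite κ]
    {s : S} {f : (κ →₀ R) →ₗ[R] Y} {f' : (κ →₀ B) →ₗ[B] Y'} (h : IsFraction S l s f f')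
    (d : (κ →₀ R) →ₗ[R] (ι →₀ R)) :
    (∃ g' : (ι →₀ B) →ₗ[B] Y', f' = g' ∘ₗ baseChangeMap B (freeLoc R B ι) d) ↔
      ∃ (t : S) (g : (ι →₀ R) →ₗ[R] Y), t • f = g ∘ₗ d := by
  constructor
  · rintro ⟨g', rfl⟩
    obtain ⟨u, g, hg⟩ := exists_isFraction (S := S) l g'
    -- Both `u • f` and `s • (g ∘ d)` localize to `(u * s) • f'`, so some element of `S` kills their
    -- difference.
    have h1 : IsFraction S l 1 (u • f - s • (g ∘ₗ d)) (0 : (κ →₀ B) →ₗ[B] Y') := fun x => by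
      have e1 := h x
      have e2 := hg.comp d x
      have e3 : l ((u • f - s • (g ∘ₗ d)) x) = u • l (f x) - s • l ((g ∘ₗ d) x) := by
        rw [LinearMap.sub_apply, map_sub]
        exact congrArg₂ _ (map_smul l (u : R) (f x)) (map_smul l (s : R) ((g ∘ₗ d) x))
      rw [e3, ← e1, ← e2, smul_smul, smul_smul, mul_comm, sub_self, LinearMap.zero_apply,
        smul_zero]
    obtain ⟨t, ht⟩ := h1.exists_smul_eq_zero
    refine ⟨t * u, (t * s) • g, ?_⟩
    rw [smul_sub, sub_eq_zero] at ht
    rw [mul_smul, ht, mul_smul]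
    rfl
  · rintro ⟨t, g, hg⟩
    obtain ⟨g', hg'⟩ := exists_isFraction_of_base (B := B) l (t * s) g
    refine ⟨g', ?_⟩
    have h1 := h.smul t
    have h2 := hg'.comp d
    have h3 : IsFraction S l (t * s) (0 : (κ →₀ R) →ₗ[R] Y)
        (f' - g' ∘ₗ baseChangeMap B (freeLoc R B ι) d) := fun x => by
      rw [LinearMap.sub_apply, smul_sub, h1 x, h2 x, hg]
      simp
    exact sub_eq_zero.mp h3.eq_zero

end Maps

end Localize

/-! ### The homogeneous localization of a graded free resolution -/

section ExactBaseChange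

variable {R : Type*} [CommRing R] {S : Submonoid R} {B : Type*} [CommRing B] [Algebra R B]
  [IsLocalization S B] {Y Y' : Type*} [AddCommGroup Y] [Module R Y] [AddCommGroup Y'] [Module R Y']
  [Module B Y'] [IsScalarTower R B Y'] {ι κ : Type*}

/-- Exactness of localization, by clearing denominators. The kernel of `l` only has to be
`S`-torsion, so `quotLoc` need not be recognized as a localization map. -/
theorem exact_baseChangeMap {d : (κ →₀ R) →ₗ[R] (ι →₀ R)} {f : (ι →₀ R) →ₗ[R] Y}
    (hex : Function.Exact d f) (l : Y →ₗ[R] Y') (hl : ∀ y, l y = 0 → ∃ u : S, (u : R) • y = 0) :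
    Function.Exact (baseChangeMap B (freeLoc R B ι) d) (baseChangeMap B l f) := by
  intro y'
  constructor
  · intro hy'
    obtain ⟨⟨y, s⟩, hs⟩ := IsLocalizedModule.surj S (freeLoc R B ι) y'
    have hs' : (s : R) • y' = freeLoc R B ι y := hs
    have h1 : l (f y) = 0 := by
      rw [← baseChangeMap_freeLoc (B := B), ← hs', LinearMap.map_smul_of_tower, hy', smul_zero]
    obtain ⟨u, hu⟩ := hl _ h1
    rw [← map_smul, hex] at hu
    obtain ⟨x, hx⟩ := hu
    refine ⟨IsLocalizedModule.mk' (freeLoc R B κ) x (u * s),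
      IsLocalizedModule.smul_injective (freeLoc R B ι) (u * s) ?_⟩
    have h2 : ((u * s : S) : R) • IsLocalizedModule.mk' (freeLoc R B κ) x (u * s) =
      freeLoc R B κ x := IsLocalizedModule.mk'_cancel' (freeLoc R B κ) x (u * s)
    change ((u * s : S) : R) • _ = ((u * s : S) : R) • y'
    rw [← LinearMap.map_smul_of_tower, h2, baseChangeMap_freeLoc, hx, map_smul, ← hs', smul_smul,
      Submonoid.coe_mul]
  · rintro ⟨x', rfl⟩
    have : baseChangeMap B l f ∘ₗ baseChangeMap B (freeLoc R B ι) d = 0 :=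
      finsupp_hom_ext_single fun j => by
        rw [LinearMap.comp_apply, baseChangeMap_single, baseChangeMap_freeLoc,
          hex.apply_apply_eq_zero, map_zero, LinearMap.zero_apply]
    exact LinearMap.congr_fun this x'

end ExactBaseChange

section HomogeneousLocalization

variable {G : Type} [AddCommGroup G] {R : Type u} [CommRing R] {𝒜 : G → AddSubgroup R}
  [SetLike.GradedMonoid 𝒜] {p : Ideal R} [p.IsPrime]

theorem homCompl_isHomogeneous (s : homCompl 𝒜 p) : ∃ d, (s : R) ∈ 𝒜 d := s.2.1

theorem isLocGrading_locModDeg {M : Type v} [AddCommGroup M] [Module R M] (ℳ : G → AddSubgroup M)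
    [SetLike.GradedSMul 𝒜 ℳ] : IsLocGrading 𝒜 (homCompl 𝒜 p) ℳ (locModDeg 𝒜 p ℳ)
      (LocalizedModule.mkLinearMap (homCompl 𝒜 p) M) := by
  intro g z
  refine exists_congr fun d => exists_congr fun s => exists_congr fun x =>
    and_congr_right fun _ => and_congr_right fun _ => ?_
  rw [IsLocalizedModule.mk_eq_mk', eq_comm, IsLocalizedModule.mk'_eq_iff, eq_comm]

theorem isLocGrading_locRingDeg : IsLocGrading 𝒜 (homCompl 𝒜 p) 𝒜 (locRingDeg 𝒜 p)
      (Algebra.linearMap R (LocRing 𝒜 p)) := by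
  intro g z
  refine exists_congr fun d => exists_congr fun s => exists_congr fun x =>
    and_congr_right fun _ => and_congr_right fun _ => ?_
  rw [Localization.mk_eq_mk', eq_comm, IsLocalization.mk'_eq_iff_eq_mul, eq_comm, mul_comm,
    ← Algebra.smul_def]
  rfl

theorem algebraMap_mem_locRingDeg {g : G} {x : R} (hx : x ∈ 𝒜 g) :
    algebraMap R (LocRing 𝒜 p) x ∈ locRingDeg 𝒜 p g :=
  (isLocGrading_locRingDeg _ _).mpr ⟨0, 1, x, SetLike.GradedOne.one_mem, by rwa [add_zero],
    by rw [one_smul]; rfl⟩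

theorem locRingDeg_isGrading (h𝒜 : IsGrading 𝒜) : IsGrading (locRingDeg 𝒜 p) :=
  isLocGrading_locRingDeg.isGrading h𝒜 homCompl_isHomogeneous

theorem locModDeg_isGrading {M : Type v} [AddCommGroup M] [Module R M] {ℳ : G → AddSubgroup M}
    [SetLike.GradedSMul 𝒜 ℳ] (hℳ : IsGrading ℳ) : IsGrading (locModDeg 𝒜 p ℳ) :=
  (isLocGrading_locModDeg ℳ).isGrading hℳ homCompl_isHomogeneous

instance locModDeg_gradedSMul {M : Type v} [AddCommGroup M] [Module R M] (ℳ : G → AddSubgroup M)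
    [SetLike.GradedSMul 𝒜 ℳ] : SetLike.GradedSMul (locRingDeg 𝒜 p) (locModDeg 𝒜 p ℳ) where
  smul_mem := by
    rintro g h _ _ ⟨d, s, x, hs, hx, rfl⟩ ⟨e, t, y, ht, hy, rfl⟩
    refine ⟨d + e, s * t, x • y, SetLike.GradedMul.mul_mem hs ht,
      graded_smul_mem hx hy ?_, LocalizedModule.mk_smul_mk _ _ _ _⟩
    rw [vadd_eq_add]
    abel

instance locRingDeg_gradedMonoid : SetLike.GradedMonoid (locRingDeg 𝒜 p) where
  one_mem := by
    rw [← map_one (algebraMap R (LocRing 𝒜 p))]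
    exact algebraMap_mem_locRingDeg SetLike.GradedOne.one_mem
  mul_mem := by
    rintro g h _ _ ⟨d, s, x, hs, hx, rfl⟩ ⟨e, t, y, ht, hy, rfl⟩
    refine ⟨d + e, s * t, x * y, SetLike.GradedMul.mul_mem hs ht, ?_, Localization.mk_mul _ _ _ _⟩
    have := SetLike.GradedMul.mul_mem hx hy
    rwa [show g + d + (h + e) = g + h + (d + e) by abel] at this

variable (𝒜 p) in
/-- The ideal `p R_(p)`. -/
abbrev locIdeal : Ideal (LocRing 𝒜 p) := p.map (algebraMap R (LocRing 𝒜 p))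

theorem locIdeal_graded (hp : Submodule.toAddSubgroup p ≤ ⨆ g, 𝒜 g ⊓ Submodule.toAddSubgroup p) :
    Submodule.toAddSubgroup (locIdeal 𝒜 p) ≤
      ⨆ g, locRingDeg 𝒜 p g ⊓ Submodule.toAddSubgroup (locIdeal 𝒜 p) := by
  intro z hz
  obtain ⟨⟨⟨a, ha⟩, s⟩, hs⟩ := (IsLocalization.mem_map_algebraMap_iff (homCompl 𝒜 p) _).mp hz
  obtain ⟨d, hd⟩ := homCompl_isHomogeneous s
  have hz' : z = IsLocalization.mk' (LocRing 𝒜 p) a s :=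
    (IsLocalization.mk'_eq_iff_eq_mul.mpr hs.symm).symm
  rw [hz']
  refine AddSubgroup.iSup_induction (C := fun a => IsLocalization.mk' (LocRing 𝒜 p) a s ∈
    ⨆ g, locRingDeg 𝒜 p g ⊓ Submodule.toAddSubgroup (locIdeal 𝒜 p)) _ (hp ha) ?_ ?_ ?_
  · rintro g a ⟨hag, hap⟩
    refine AddSubgroup.mem_iSup_of_mem (g - d) ⟨⟨d, s, a, hd, ?_, ?_⟩, ?_⟩
    · rwa [sub_add_cancel]
    · rw [Localization.mk_eq_mk']
    · exact (IsLocalization.mem_map_algebraMap_iff (homCompl 𝒜 p) _).mpr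
        ⟨⟨⟨a, hap⟩, s⟩, IsLocalization.mk'_spec _ _ _⟩
  · rw [IsLocalization.mk'_zero]
    exact zero_mem _
  · intro x y hx hy
    rw [← Localization.mk_eq_mk', ← Localization.add_mk_self, Localization.mk_eq_mk']
    exact add_mem hx hy

variable (𝒜 p) in
/-- The canonical map `R / p → R_(p) / p R_(p)`. -/
def quotLoc : R ⧸ p →ₗ[R] LocRing 𝒜 p ⧸ locIdeal 𝒜 p :=
  Submodule.liftQ p ((Ideal.Quotient.mkₐ R (locIdeal 𝒜 p)).toLinearMap ∘ₗ
    Algebra.linearMap R (LocRing 𝒜 p)) fun _ hx =>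
      Ideal.Quotient.eq_zero_iff_mem.mpr (Ideal.mem_map_of_mem _ hx)

theorem quotLoc_mk (x : R) : quotLoc 𝒜 p (Ideal.Quotient.mk p x) =
    Ideal.Quotient.mk (locIdeal 𝒜 p) (algebraMap R (LocRing 𝒜 p) x) := rfl

theorem exists_smul_eq_zero_of_quotLoc {y : R ⧸ p} (h : quotLoc 𝒜 p y = 0) :
    ∃ u : homCompl 𝒜 p, (u : R) • y = 0 := by
  obtain ⟨x, rfl⟩ := Ideal.Quotient.mk_surjective y
  rw [quotLoc_mk, Ideal.Quotient.eq_zero_iff_mem,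
    IsLocalization.algebraMap_mem_map_algebraMap_iff (homCompl 𝒜 p)] at h
  obtain ⟨m, hm, h⟩ := h
  exact ⟨⟨m, hm⟩, Ideal.Quotient.eq_zero_iff_mem.mpr h⟩

theorem freeLoc_mem {ι : Type*} {δ : ι → G} {g : G} {x : ι →₀ R} (hx : x ∈ freeDeg 𝒜 δ g) :
    freeLoc R (LocRing 𝒜 p) ι x ∈ freeDeg (locRingDeg 𝒜 p) δ g := fun j =>
  algebraMap_mem_locRingDeg (hx j)

theorem exists_freeLoc_eq_zero {ι : Type*} (y : ι →₀ R) (h : freeLoc R (LocRing 𝒜 p) ι y = 0) :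
    ∃ u : homCompl 𝒜 p, (u : R) • y = 0 :=
  (IsLocalizedModule.eq_zero_iff (homCompl 𝒜 p) _).mp h

/-- The homogeneous localization of a graded free resolution of `R / p`. -/
def GrRes.localize (P : GrRes.{w} 𝒜 (quotDeg 𝒜 p)) :
    GrRes.{w} (locRingDeg 𝒜 p) (quotDeg (locRingDeg 𝒜 p) (locIdeal 𝒜 p)) where
  ι := P.ι
  δ := P.δ
  d n := baseChangeMap (LocRing 𝒜 p) (freeLoc R (LocRing 𝒜 p) (P.ι n)) (P.d n)
  ε := baseChangeMap (LocRing 𝒜 p) (quotLoc 𝒜 p) P.ε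
  d_mem n j := by
    rw [baseChangeMap_single]
    exact freeLoc_mem (P.d_mem n j)
  ε_mem j := by
    rw [baseChangeMap_single]
    obtain ⟨a, ha, e⟩ := P.ε_mem j
    rw [← e]
    exact ⟨algebraMap R (LocRing 𝒜 p) a, algebraMap_mem_locRingDeg ha, rfl⟩
  ε_surj := by
    rintro g _ ⟨_, ⟨d, s, a, hs, ha, rfl⟩, rfl⟩
    obtain ⟨y, hy, hya⟩ := P.ε_surj (g + d) (Ideal.Quotient.mk p a) ⟨a, ha, rfl⟩
    refine ⟨Localization.mk 1 s • freeLoc R (LocRing 𝒜 p) (P.ι 0) y, ?_, ?_⟩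
    · have h1 : Localization.mk 1 s ∈ locRingDeg 𝒜 p (-d) :=
        ⟨d, s, 1, hs, by rw [neg_add_cancel]; exact SetLike.GradedOne.one_mem, rfl⟩
      exact graded_smul_mem h1 (freeLoc_mem hy) (by abel)
    · rw [map_smul, baseChangeMap_freeLoc, hya, quotLoc_mk]
      have h2 : Localization.mk a s = Localization.mk 1 s * algebraMap R (LocRing 𝒜 p) a := by
        rw [← Localization.mk_one_eq_algebraMap, Localization.mk_mul, one_mul, mul_one]
      rw [h2]
      rfl
  exact_zero := exact_baseChangeMap (S := homCompl 𝒜 p) P.exact_zero _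
    fun _ h => exists_smul_eq_zero_of_quotLoc h
  exact_succ n := exact_baseChangeMap (S := homCompl 𝒜 p) (P.exact_succ n) _
    exists_freeLoc_eq_zero

/-- `Hom(P, M)` has in cohomological degree `i` a class of internal degree `a` not annihilated by
any element of `S`. -/
def GrRes.StableClassAt {𝒩 : G → AddSubgroup (R ⧸ p)} (P : GrRes.{w} 𝒜 𝒩) {M : Type v}
    [AddCommGroup M] [Module R M] (S : Submonoid R) (ℳ : G → AddSubgroup M) (i : ℕ) (a : G) :
    Prop :=
  ∃ f : (P.ι i →₀ R) →ₗ[R] M, (∀ j, f (Finsupp.single j 1) ∈ ℳ (P.δ i j + a)) ∧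
    f ∘ₗ P.d i = 0 ∧ ∀ s : S, ¬ P.IsCob i (s • f)

theorem GrRes.isCob_localize_iff (P : GrRes.{w} 𝒜 (quotDeg 𝒜 p)) [∀ n, Finite (P.ι n)]
    {M : Type v} [AddCommGroup M] [Module R M] {i : ℕ} {s : homCompl 𝒜 p}
    {f : (P.ι i →₀ R) →ₗ[R] M} {f' : (P.ι i →₀ LocRing 𝒜 p) →ₗ[LocRing 𝒜 p] LocMod 𝒜 p M}
    (h : IsFraction _ (LocalizedModule.mkLinearMap (homCompl 𝒜 p) M) s f f') :
    P.localize.IsCob i f' ↔ ∃ t : homCompl 𝒜 p, P.IsCob i (t • f) := by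
  cases i with
  | zero =>
    constructor
    · intro hf'
      have hf'' : f' = 0 := hf'
      subst hf''
      exact h.exists_smul_eq_zero
    · rintro ⟨t, ht⟩
      have h1 := h.smul t
      rw [show t • f = 0 from ht] at h1
      exact h1.eq_zero
  | succ i => exact h.exists_comp_iff (P.d i)

/-- A homogeneous cocycle over `R_(p)` is a fraction with homogeneous denominator, because `P_i` has
finite rank. The degree of the denominator is the shift `d`. -/
theorem GrRes.nonvanishingAt_localize_iff (P : GrRes.{w} 𝒜 (quotDeg 𝒜 p)) [∀ n, Finite (P.ι n)]
    {M : Type v} [AddCommGroup M] [Module R M] (ℳ : G → AddSubgroup M) [SetLike.GradedSMul 𝒜 ℳ]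
    (i : ℕ) (a : G) : P.localize.NonvanishingAt (locModDeg 𝒜 p ℳ) i a ↔
      ∃ d, (∃ s : homCompl 𝒜 p, (s : R) ∈ 𝒜 d) ∧
        P.StableClassAt (homCompl 𝒜 p) ℳ i (a + d) := by
  constructor
  · intro h
    obtain ⟨f', hdeg, hf', hcob⟩ :
      ∃ f' : (P.ι i →₀ LocRing 𝒜 p) →ₗ[LocRing 𝒜 p] LocMod 𝒜 p M,
        (∀ j, f' (Finsupp.single j 1) ∈ locModDeg 𝒜 p ℳ (P.δ i j + a)) ∧
        f' ∘ₗ baseChangeMap (LocRing 𝒜 p) (freeLoc R (LocRing 𝒜 p) (P.ι i)) (P.d i) = 0 ∧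
        ¬ P.localize.IsCob i f' := h
    have := Fintype.ofFinite (P.ι i)
    obtain ⟨d, s, hs, hy⟩ := (isLocGrading_locModDeg (p := p) ℳ).exists_common_denominator
      Finset.univ (fun j => f' (Finsupp.single j 1)) (fun j => P.δ i j + a) fun j _ => hdeg j
    choose y hy hsy using fun j => hy j (Finset.mem_univ j)
    have hfrac : IsFraction _ (LocalizedModule.mkLinearMap (homCompl 𝒜 p) M) s
        (Finsupp.linearCombination R y) f' := isFraction_iff.mpr fun j => by
      rw [hsy j, Finsupp.linearCombination_single, one_smul]
    -- The numerator is a cocycle only up to `S`-torsion. Multiplication by `t` repairs this and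
    -- adds `e` to the shift.
    have hd := hfrac.comp (P.d i)
    rw [hf'] at hd
    obtain ⟨t, ht⟩ := hd.exists_smul_eq_zero
    obtain ⟨e, he⟩ := homCompl_isHomogeneous t
    refine ⟨e + d, ⟨t * s, SetLike.GradedMul.mul_mem he hs⟩, t • Finsupp.linearCombination R y,
      fun j => ?_, ?_, fun t' ht' => hcob ?_⟩
    · rw [LinearMap.smul_apply, Finsupp.linearCombination_single, one_smul]
      exact graded_smul_mem (a := (t : R)) he (hy j) (by abel)
    · exact ht
    · exact (P.isCob_localize_iff (hfrac.smul t)).mpr ⟨t', ht'⟩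
  · rintro ⟨d, ⟨s, hs⟩, f, hdeg, hf, hcob⟩
    obtain ⟨f', hf'⟩ := exists_isFraction_of_base (B := LocRing 𝒜 p)
      (LocalizedModule.mkLinearMap (homCompl 𝒜 p) M) s f
    refine ⟨f', fun j => (isLocGrading_locModDeg (p := p) ℳ _ _).mpr
      ⟨d, s, f (Finsupp.single j 1), hs, ?_, isFraction_iff.mp hf' j⟩, ?_, fun hc => ?_⟩
    · rw [add_assoc]
      exact hdeg j
    · have hd := hf'.comp (P.d i)
      rw [hf] at hd
      exact hd.eq_zero
    · obtain ⟨t, ht⟩ := (P.isCob_localize_iff hf').mp hc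
      exact hcob t ht

end HomogeneousLocalization

theorem starExtDeg_resField_ne_bot_iff {r : ℕ} {R : Type u} [CommRing R]
    {𝒜 : (Fin r → ℤ) → AddSubgroup R} [SetLike.GradedMonoid 𝒜] (h𝒜 : IsGrading 𝒜) {p : Ideal R}
    [p.IsPrime] (hp : Submodule.toAddSubgroup p ≤ ⨆ g, 𝒜 g ⊓ Submodule.toAddSubgroup p)
    (P : GrRes.{w} 𝒜 (quotDeg 𝒜 p)) [∀ n, Finite (P.ι n)]
    {M : Type v} [AddCommGroup M] [Module R M] {ℳ : (Fin r → ℤ) → AddSubgroup M}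
    [SetLike.GradedSMul 𝒜 ℳ] (hℳ : IsGrading ℳ) (i : ℕ) (a : Fin r → ℤ) :
    starExtDeg (locRingDeg 𝒜 p) (locModDeg 𝒜 p ℳ) (resField 𝒜 p) i a ≠ ⊥ ↔
      ∃ d, (∃ s : homCompl 𝒜 p, (s : R) ∈ 𝒜 d) ∧
        P.StableClassAt (homCompl 𝒜 p) ℳ i (a + d) := by
  have h𝒜' : IsGrading (locRingDeg 𝒜 p) := locRingDeg_isGrading h𝒜
  have hN : IsGrading (resField 𝒜 p).deg := quotDeg_isGrading h𝒜' (locIdeal_graded hp)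
  have : SetLike.GradedSMul (locRingDeg 𝒜 p) (resField 𝒜 p).deg :=
    quotDeg_gradedSMul (locIdeal 𝒜 p)
  rw [← P.nonvanishingAt_localize_iff ℳ i a,
    starExtDeg_ne_bot_iff h𝒜' (locModDeg_isGrading hℳ) _ hN]
  exact (canonicalRes h𝒜' (resField 𝒜 p) hN).nonvanishingAt_iff P.localize h𝒜'

/-! ### Components of cochains -/

section Components

variable {G : Type*} [AddCommGroup G] {A : Type*} [CommRing A] {𝒜 : G → AddSubgroup A}
  {M : Type*} [AddCommGroup M] [Module A M] {ℳ : G → AddSubgroup M} {ι : Type*}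

theorem linearComponent_sum (hℳ : IsGrading ℳ) (δ : ι → G) (a : G) {α : Type*} (s : Finset α)
    (f : α → (ι →₀ A) →ₗ[A] M) :
    linearComponent hℳ δ a (∑ k ∈ s, f k) = ∑ k ∈ s, linearComponent hℳ δ a (f k) :=
  finsupp_hom_ext_single fun j => by
    simp only [linearComponent_single, LinearMap.sum_apply, map_sum]

theorem linearComponent_smul [SetLike.GradedSMul 𝒜 ℳ] (h𝒜 : IsGrading 𝒜) (hℳ : IsGrading ℳ)
    {δ : ι → G} {b : G} {f : (ι →₀ A) →ₗ[A] M}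
    (hf : ∀ j, f (Finsupp.single j 1) ∈ ℳ (δ j + b)) (g : G) (c : A) :
    linearComponent hℳ δ (g + b) (c • f) = h𝒜.proj g c • f :=
  finsupp_hom_ext_single fun j => by
    rw [linearComponent_single, LinearMap.smul_apply, LinearMap.smul_apply,
      ← h𝒜.proj_smul hℳ g c (hf j), add_left_comm]

/-- Finite rank is essential: the values on the basis then involve only finitely many degrees `g - δ
j`. -/
theorem exists_eq_sum_linearComponent [Finite ι] (hℳ : IsGrading ℳ) (δ : ι → G)
    (f : (ι →₀ A) →ₗ[A] M) : ∃ F : Finset G, f = ∑ n ∈ F, linearComponent hℳ δ n f := by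
  classical
  have := Fintype.ofFinite ι
  refine ⟨Finset.univ.biUnion fun j =>
    (hℳ.components (f (Finsupp.single j 1))).support.image (· - δ j),
    finsupp_hom_ext_single fun j => ?_⟩
  rw [LinearMap.sum_apply]
  simp only [linearComponent_single]
  rw [← Finset.sum_subset (Finset.subset_biUnion_of_mem
    (fun j => (hℳ.components (f (Finsupp.single j 1))).support.image (· - δ j))
    (Finset.mem_univ j)), Finset.sum_image fun _ _ _ _ h => sub_left_injective h]
  · conv_lhs => rw [← hℳ.components_sum (f (Finsupp.single j 1))]
    refine Finset.sum_congr rfl fun g _ => ?_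
    rw [add_sub_cancel]
    rfl
  · intro n _ hn
    by_contra h
    refine hn (Finset.mem_image.mpr ⟨δ j + n, Finsupp.mem_support_iff.mpr h, ?_⟩)
    abel

theorem GrRes.isCob_linearComponent {N : Type*} [AddCommGroup N] [Module A N]
    {𝒩 : G → AddSubgroup N} (P : GrRes 𝒜 𝒩) [SetLike.GradedSMul 𝒜 ℳ] (hℳ : IsGrading ℳ) {i : ℕ}
    {f : (P.ι i →₀ A) →ₗ[A] M} (hf : P.IsCob i f) (a : G) :
    P.IsCob i (linearComponent hℳ (P.δ i) a f) := by
  cases i with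
  | zero =>
    refine finsupp_hom_ext_single fun j => ?_
    rw [show f = 0 from hf, linearComponent_single, LinearMap.zero_apply, map_zero]
  | succ i =>
    obtain ⟨g, rfl⟩ := hf
    exact ⟨linearComponent hℳ (P.δ i) a g, (linearComponent_comp hℳ _ _ a g _ (P.d_mem i)).symm⟩

theorem GrRes.linearComponent_comp_d {N : Type*} [AddCommGroup N] [Module A N]
    {𝒩 : G → AddSubgroup N} (P : GrRes 𝒜 𝒩) [SetLike.GradedSMul 𝒜 ℳ] (hℳ : IsGrading ℳ) {i : ℕ}
    {f : (P.ι i →₀ A) →ₗ[A] M} (hf : f ∘ₗ P.d i = 0) (a : G) :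
    linearComponent hℳ (P.δ i) a f ∘ₗ P.d i = 0 := by
  rw [linearComponent_comp hℳ _ (P.δ (i + 1)) a f _ (P.d_mem i), hf]
  exact finsupp_hom_ext_single fun j => by simp [linearComponent_single]

theorem GrRes.IsCob.sum {N : Type*} [AddCommGroup N] [Module A N]
    {𝒩 : G → AddSubgroup N} {P : GrRes 𝒜 𝒩} {i : ℕ} {α : Type*} {s : Finset α}
    {f : α → (P.ι i →₀ A) →ₗ[A] M} (h : ∀ k ∈ s, P.IsCob i (f k)) : P.IsCob i (∑ k ∈ s, f k) :=
  Finset.sum_induction f (P.IsCob i) (fun _ _ ha hb => ha.add hb) (IsCob.zero P i) h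

end Components

/-! ### Coarsening -/

section CoarsenResolution

variable {G H : Type} [AddCommGroup G] [AddCommGroup H] {R : Type u} [CommRing R]
  {𝒜 : G → AddSubgroup R} {p : Ideal R}

/-- A graded free resolution of `R / p`, considered with a coarser grading. -/
def GrRes.coarsen (P : GrRes.{w} 𝒜 (quotDeg 𝒜 p)) (φ : G →+ H) :
    GrRes.{w} (coarsen φ 𝒜) (quotDeg (MultiGraded.coarsen φ 𝒜) p) where
  ι := P.ι
  δ n j := φ (P.δ n j)
  d := P.d
  ε := P.ε
  d_mem n j k := by
    rw [← map_sub]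
    exact le_coarsen φ 𝒜 _ (P.d_mem n j k)
  ε_mem j := AddSubgroup.map_mono (le_coarsen φ 𝒜 _) (P.ε_mem j)
  ε_surj := by
    rintro h _ ⟨a, ha, rfl⟩
    refine mem_coarsen_induction (motive := fun a => ∃ y ∈ freeDeg (MultiGraded.coarsen φ 𝒜)
      (fun j => φ (P.δ 0 j)) h, P.ε y = Ideal.Quotient.mk p a) ha ?_ ?_ ?_
    · rintro g rfl a ha
      obtain ⟨y, hy, e⟩ := P.ε_surj g (Ideal.Quotient.mk p a) ⟨a, ha, rfl⟩
      refine ⟨y, fun j => ?_, e⟩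
      rw [← map_sub]
      exact le_coarsen φ 𝒜 _ (hy j)
    · exact ⟨0, zero_mem _, by simp⟩
    · rintro a b ⟨y, hy, e⟩ ⟨z, hz, e'⟩
      exact ⟨y + z, add_mem hy hz, by rw [map_add, map_add, e, e']⟩
  exact_zero := P.exact_zero
  exact_succ := P.exact_succ

theorem GrRes.isCob_coarsen_iff (P : GrRes.{w} 𝒜 (quotDeg 𝒜 p)) (φ : G →+ H) {M : Type v}
    [AddCommGroup M] [Module R M] {i : ℕ} (f : (P.ι i →₀ R) →ₗ[R] M) :
    (P.coarsen φ).IsCob i f ↔ P.IsCob i f := by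
  cases i <;> exact Iff.rfl

theorem coarsen_graded {p : Ideal R}
    (hp : Submodule.toAddSubgroup p ≤ ⨆ g, 𝒜 g ⊓ Submodule.toAddSubgroup p) (φ : G →+ H) :
    Submodule.toAddSubgroup p ≤ ⨆ h, coarsen φ 𝒜 h ⊓ Submodule.toAddSubgroup p :=
  hp.trans (iSup_le fun g => le_iSup_of_le (φ g) (inf_le_inf_right _ (le_coarsen φ 𝒜 g)))

variable [SetLike.GradedMonoid 𝒜] [p.IsPrime]

theorem homCompl_le_coarsen (φ : G →+ H) : homCompl 𝒜 p ≤ homCompl (coarsen φ 𝒜) p :=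
  inf_le_inf_right _ fun _ ⟨g, hg⟩ => ⟨φ g, le_coarsen φ 𝒜 g hg⟩

theorem exists_proj_mem_homCompl (h𝒜 : IsGrading 𝒜) {t : R} (ht : t ∉ p) :
    ∃ g, h𝒜.proj g t ∈ homCompl 𝒜 p := by
  by_contra! h
  refine ht (h𝒜.mem_of_forall_proj (Submodule.toAddSubgroup p) fun g => ?_)
  by_contra hg
  exact h g ⟨⟨g, h𝒜.proj_mem g t⟩, hg⟩

theorem GrRes.stableClassAt_coarsen_iff (P : GrRes.{w} 𝒜 (quotDeg 𝒜 p)) [∀ n, Finite (P.ι n)]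
    (h𝒜 : IsGrading 𝒜) {M : Type v} [AddCommGroup M] [Module R M] {ℳ : G → AddSubgroup M}
    [SetLike.GradedSMul 𝒜 ℳ] (hℳ : IsGrading ℳ) (φ : G →+ H) (i : ℕ) (a : H) :
    (∃ n, φ n = a ∧ ∃ d, (∃ s : homCompl 𝒜 p, (s : R) ∈ 𝒜 d) ∧
        P.StableClassAt (homCompl 𝒜 p) ℳ i (n + d)) ↔
      ∃ d, (∃ t : homCompl (MultiGraded.coarsen φ 𝒜) p, (t : R) ∈ MultiGraded.coarsen φ 𝒜 d) ∧
        (P.coarsen φ).StableClassAt (homCompl (MultiGraded.coarsen φ 𝒜) p)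
          (MultiGraded.coarsen φ ℳ) i (a + d) := by
  constructor
  · rintro ⟨n, rfl, d, ⟨s, hs⟩, f, hdeg, hf, hstable⟩
    refine ⟨φ d, ⟨⟨s, homCompl_le_coarsen φ s.2⟩, le_coarsen φ 𝒜 d hs⟩, f, fun j => ?_, hf,
      fun t ht => ?_⟩
    · have := le_coarsen φ ℳ _ (hdeg j)
      rwa [map_add, map_add] at this
    -- As `f` is homogeneous of degree `n + d`, the component of `t • f` of degree `g + (n + d)` is
    -- `t_g • f`, with `t_g` in the smaller multiplicative set.
    · obtain ⟨g, hg⟩ := exists_proj_mem_homCompl h𝒜 (t := t) t.2.2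
      have ht' : P.IsCob i ((t : R) • f) := (P.isCob_coarsen_iff φ _).mp ht
      have h1 := P.isCob_linearComponent hℳ ht' (g + (n + d))
      rw [linearComponent_smul h𝒜 hℳ hdeg] at h1
      exact hstable ⟨_, hg⟩ h1
  · rintro ⟨d, ⟨t, ht⟩, hclass⟩
    obtain ⟨f, hdeg, hf, hstable⟩ : ∃ f : (P.ι i →₀ R) →ₗ[R] M,
      (∀ j, f (Finsupp.single j 1) ∈ MultiGraded.coarsen φ ℳ (φ (P.δ i j) + (a + d))) ∧
      f ∘ₗ P.d i = 0 ∧ ∀ s : homCompl (MultiGraded.coarsen φ 𝒜) p,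
        ¬ (P.coarsen φ).IsCob i (s • f) := hclass
    -- A component of `t` outside `p` provides a fine degree `e` above the coarse shift `d`.
    obtain ⟨e, he⟩ := exists_proj_mem_homCompl h𝒜 (t := t) t.2.2
    have hed : φ e = d := by
      by_contra h
      refine he.2 ?_
      rw [h𝒜.proj_of_mem_coarsen ht h]
      exact zero_mem _
    by_contra! hcon
    -- If no fine component is stable, each has its own multiplier `s n`. Components with `φ n ≠ a +
    -- d` vanish. The product of the `s n` over the finitely many degrees of `f` then contradicts
    -- the stability of `f`.
    have h1 : ∀ n, ∃ s : homCompl 𝒜 p, P.IsCob i (s • linearComponent hℳ (P.δ i) n f) := by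
      intro n
      by_cases hn : φ n = a + d
      · by_contra! h
        refine hcon (n - e) (by rw [map_sub, hn, hed, add_sub_cancel_right]) e
          ⟨⟨_, he⟩, h𝒜.proj_mem _ _⟩ ⟨linearComponent hℳ (P.δ i) n f, fun j => ?_,
            P.linearComponent_comp_d hℳ hf n, h⟩
        rw [linearComponent_single, sub_add_cancel]
        exact hℳ.proj_mem _ _
      · refine ⟨1, ?_⟩
        have : linearComponent hℳ (P.δ i) n f = 0 := finsupp_hom_ext_single fun j => by
          rw [linearComponent_single, LinearMap.zero_apply]
          refine hℳ.proj_of_mem_coarsen (hdeg j) fun e' => hn ?_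
          rw [map_add] at e'
          exact add_left_cancel e'
        rw [this, smul_zero]
        exact IsCob.zero P i
    choose s hs using h1
    obtain ⟨F, hF⟩ := exists_eq_sum_linearComponent hℳ (P.δ i) f
    refine hstable ⟨_, homCompl_le_coarsen φ (∏ n ∈ F, s n).2⟩ ((P.isCob_coarsen_iff φ _).mpr ?_)
    change P.IsCob i ((∏ n ∈ F, s n) • f)
    rw [hF, Finset.smul_sum]
    refine IsCob.sum fun n hn => ?_
    classical
    rw [← Finset.prod_erase_mul _ _ hn, mul_smul]
    exact (hs n).smul _

end CoarsenResolution

/-! ### Directions of a graded prime in a standard graded ring. -/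

section Directions

variable {r : ℕ} {R : Type u} [CommRing R] {𝒜 : (Fin r → ℤ) → AddSubgroup R} {p : Ideal R}

/-- In a standard graded ring a homogeneous element whose degree is nonzero in some
`p`-direction belongs to `p`. -/
theorem mem_of_mem_dir [SetLike.GradedMonoid 𝒜] (h𝒜 : IsGrading 𝒜) (hstd : IsStandard 𝒜)
    (hp : Submodule.toAddSubgroup p ≤ ⨆ g, 𝒜 g ⊓ Submodule.toAddSubgroup p) {j : Fin r}
    (hj : j ∈ dir 𝒜 p) {n : Fin r → ℤ} (hn : n j ≠ 0) {x : R} (hx : x ∈ 𝒜 n) : x ∈ p := by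
  set e : (Fin r → ℤ) →+ ℤ := Pi.evalAddMonoidHom (fun _ => ℤ) j with he
  have hj' : (𝒜 (Pi.single j 1) : Set R) ⊆ p := by
    simpa [dir] using hj
  -- Modulo `p` the generators in `R_{e_j}` vanish and all others have `j`-th degree zero, so every
  -- element is congruent to one of `j`-th degree zero.
  have key : ∀ y : R, ∃ w ∈ coarsen e 𝒜 0, y - w ∈ p := by
    intro y
    have hy : y ∈ Subring.closure ((𝒜 0 : Set R) ∪ ⋃ j : Fin r, (𝒜 (Pi.single j 1) : Set R)) := by
      rw [show Subring.closure _ = ⊤ from hstd]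
      trivial
    induction hy using Subring.closure_induction with
    | mem y hy =>
      rcases hy with hy | hy
      · exact ⟨y, by simpa using le_coarsen e 𝒜 0 hy, by simp⟩
      · obtain ⟨k, hk⟩ := Set.mem_iUnion.mp hy
        by_cases hkj : k = j
        · subst hkj
          exact ⟨0, zero_mem _, by simpa using hj' hk⟩
        · refine ⟨y, ?_, by simp⟩
          have := le_coarsen e 𝒜 _ hk
          rwa [he, Pi.evalAddMonoidHom_apply, Pi.single_eq_of_ne (Ne.symm hkj)] at this
    | zero => exact ⟨0, zero_mem _, by simp⟩
    | one => exact ⟨1, SetLike.GradedOne.one_mem, by simp⟩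
    | add y z _ _ hy hz =>
      obtain ⟨w, hw, hyw⟩ := hy
      obtain ⟨w', hw', hzw'⟩ := hz
      exact ⟨w + w', add_mem hw hw', by rw [add_sub_add_comm]; exact add_mem hyw hzw'⟩
    | neg y _ hy =>
      obtain ⟨w, hw, hyw⟩ := hy
      exact ⟨-w, neg_mem hw, by rw [neg_sub_neg, ← neg_sub]; exact neg_mem hyw⟩
    | mul y z _ _ hy hz =>
      obtain ⟨w, hw, hyw⟩ := hy
      obtain ⟨w', hw', hzw'⟩ := hz
      refine ⟨w * w', by simpa using SetLike.GradedMul.mul_mem hw hw', ?_⟩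
      rw [show y * z - w * w' = z * (y - w) + w * (z - w') by ring]
      exact add_mem (p.mul_mem_left _ hyw) (p.mul_mem_left _ hzw')
  obtain ⟨w, hw, hxw⟩ := key x
  -- In degree `n` the element `w` has no component, so the component of `x - w`, which lies in `p`,
  -- is `x` itself.
  have h1 := h𝒜.proj_mem_of_le_iSup hp (K := Submodule.toAddSubgroup p) hxw n
  rwa [map_sub, h𝒜.proj_of_mem hx, h𝒜.proj_of_mem_coarsen hw hn, sub_zero] at h1

theorem mem_of_dirMap_ne_zero [SetLike.GradedMonoid 𝒜] (h𝒜 : IsGrading 𝒜) (hstd : IsStandard 𝒜)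
    (hp : Submodule.toAddSubgroup p ≤ ⨆ g, 𝒜 g ⊓ Submodule.toAddSubgroup p) {n : Fin r → ℤ}
    (hn : dirMap 𝒜 p n ≠ 0) {x : R} (hx : x ∈ 𝒜 n) : x ∈ p := by
  obtain ⟨k, hk⟩ := Function.ne_iff.mp hn
  exact mem_of_mem_dir h𝒜 hstd hp (Finset.orderEmbOfFin_mem (dir 𝒜 p) rfl k) hk hx

theorem dir_coarsen [SetLike.GradedMonoid 𝒜] (h𝒜 : IsGrading 𝒜) (hstd : IsStandard 𝒜)
    (hp : Submodule.toAddSubgroup p ≤ ⨆ g, 𝒜 g ⊓ Submodule.toAddSubgroup p) :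
    dir (coarsen (dirMap 𝒜 p) 𝒜) p = Finset.univ := by
  classical
  refine Finset.filter_true_of_mem fun k _ => ?_
  have : coarsen (dirMap 𝒜 p) 𝒜 (Pi.single k 1) ≤ Submodule.toAddSubgroup p :=
    iSup₂_le fun n hn x hx => mem_of_dirMap_ne_zero h𝒜 hstd hp (by rw [hn]; simp) hx
  exact this

theorem numDir_coarsen [SetLike.GradedMonoid 𝒜] (h𝒜 : IsGrading 𝒜) (hstd : IsStandard 𝒜)
    (hp : Submodule.toAddSubgroup p ≤ ⨆ g, 𝒜 g ⊓ Submodule.toAddSubgroup p) :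
    numDir (coarsen (dirMap 𝒜 p) 𝒜) p = numDir 𝒜 p := by
  rw [numDir, dir_coarsen h𝒜 hstd hp, Finset.card_univ, Fintype.card_fin]

/-- The increasing enumeration of the full index set is unique, hence given by the cast. -/
theorem dirMap_of_dir_eq_univ {q : ℕ} {ℬ : (Fin q → ℤ) → AddSubgroup R}
    (hdir : dir ℬ p = Finset.univ) (h : numDir ℬ p = q) (n : Fin q → ℤ) :
    dirMap ℬ p n = n ∘ Fin.cast h := by
  have := Finset.orderEmbOfFin_unique (s := dir ℬ p) rfl (f := Fin.cast h) (by simp [hdir])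
    fun _ _ h => h
  funext k
  exact congrArg n (congrFun this k).symm

theorem coarsen_ne_bot_iff {G H : Type} [AddCommGroup G] [AddCommGroup H] {N : Type*}
    [AddCommGroup N] (φ : G →+ H) (𝒩 : G → AddSubgroup N) (h : H) :
    coarsen φ 𝒩 h ≠ ⊥ ↔ ∃ g, φ g = h ∧ 𝒩 g ≠ ⊥ := by
  simp only [coarsen, ne_eq, iSup_eq_bot, not_forall, exists_prop]

end Directions

/-! ### Finiteness -/

section Finiteness

variable {G H : Type} [AddCommGroup G] [AddCommGroup H] {R : Type u} [CommRing R]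
  [IsNoetherianRing R] {𝒜 : G → AddSubgroup R} [SetLike.GradedMonoid 𝒜]
  {M : Type v} [AddCommGroup M] [Module R M]

/-- The homogeneous maps of degree `a` from a graded free module. -/
def homDeg {ι : Type*} (δ : ι → G) (ℳ : G → AddSubgroup M) (a : G) :
    AddSubgroup ((ι →₀ R) →ₗ[R] M) where
  carrier := {f | ∀ j, f (Finsupp.single j 1) ∈ ℳ (δ j + a)}
  zero_mem' := fun _ => zero_mem _
  add_mem' := fun hf hg j => add_mem (hf j) (hg j)
  neg_mem' := fun hf j => neg_mem (hf j)

/-- The cocycles form a finitely generated module, and every stable class has the `φ`-degree of one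
of its homogeneous generators. -/
theorem GrRes.finite_stable_degrees {p : Ideal R} [p.IsPrime] (P : GrRes.{w} 𝒜 (quotDeg 𝒜 p))
    [∀ n, Finite (P.ι n)] (h𝒜 : IsGrading 𝒜) {ℳ : G → AddSubgroup M} [SetLike.GradedSMul 𝒜 ℳ]
    (hℳ : IsGrading ℳ) [Module.Finite R M] (φ : G →+ H)
    (hφ : ∀ g, φ g ≠ 0 → ∀ x ∈ 𝒜 g, x ∈ p) (i : ℕ) :
    {a | ∃ n, φ n = a ∧ ∃ d, (∃ s : homCompl 𝒜 p, (s : R) ∈ 𝒜 d) ∧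
        P.StableClassAt (homCompl 𝒜 p) ℳ i (n + d)}.Finite := by
  let Z : Submodule R ((P.ι i →₀ R) →ₗ[R] M) := LinearMap.ker (LinearMap.lcomp R M (P.d i))
  have hZ : Z.FG := IsNoetherian.noetherian Z
  have hgr : Z.toAddSubgroup ≤ ⨆ g, homDeg (P.δ i) ℳ g ⊓ Z.toAddSubgroup := by
    intro f hf
    obtain ⟨F, hF⟩ := exists_eq_sum_linearComponent hℳ (P.δ i) f
    rw [hF]
    refine sum_mem fun n _ => AddSubgroup.mem_iSup_of_mem n ⟨fun j => ?_,
      P.linearComponent_comp_d hℳ hf n⟩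
    rw [linearComponent_single]
    exact hℳ.proj_mem _ _
  obtain ⟨k, x, δ, hx, hspan⟩ := exists_homogeneous_generators _ hZ hgr
  refine (Set.finite_range fun j => φ (δ j)).subset ?_
  rintro _ ⟨n, rfl, d, ⟨s, hs⟩, f, hdeg, hf, hstable⟩
  -- The shift is the degree of an element outside `p`, hence invisible to `φ`.
  have hd : φ d = 0 := by
    by_contra h
    exact s.2.2 (hφ d h s hs)
  have hfZ : f ∈ Submodule.span R (Set.range x) := by
    rw [hspan]
    exact hf
  obtain ⟨c, hc⟩ := (Submodule.mem_span_range_iff_exists_fun R).mp hfZ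
  by_contra hn
  refine hstable 1 ?_
  rw [one_smul, ← linearComponent_of_homogeneous hℳ hdeg, ← hc, linearComponent_sum]
  refine IsCob.sum fun j _ => ?_
  have hxZ : x j ∈ Z := hspan ▸ Submodule.subset_span ⟨j, rfl⟩
  -- The component of `c j • x j` of degree `n + d` involves only the component of `c j` of degree
  -- `n + d - δ j`. Its `φ`-degree `φ n - φ (δ j)` is nonzero, so this coefficient lies in `p` and
  -- annihilates `R/p`.
  rw [← sub_add_cancel (n + d) (δ j), linearComponent_smul h𝒜 hℳ (hx j)]
  refine P.isCob_smul_of_annihilates (fun y => ?_) hxZ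
  have hmem : h𝒜.proj (n + d - δ j) (c j) ∈ p := by
    refine hφ _ (fun h => hn ⟨j, ?_⟩) _ (h𝒜.proj_mem _ _)
    rw [map_sub, map_add, hd, add_zero, sub_eq_zero] at h
    exact h.symm
  obtain ⟨y, rfl⟩ := Ideal.Quotient.mk_surjective y
  exact Ideal.Quotient.eq_zero_iff_mem.mpr (p.mul_mem_right y hmem)

end Finiteness

/-! ### Anchor points in terms of stable classes, and the theorem. -/

theorem graded_of_isHomogeneous {G : Type*} [AddCommMonoid G] [DecidableEq G] {R : Type*}
    [CommRing R] {𝒜 : G → AddSubgroup R} [GradedRing 𝒜] {p : Ideal R} (hp : p.IsHomogeneous 𝒜) :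
    Submodule.toAddSubgroup p ≤ ⨆ g, 𝒜 g ⊓ Submodule.toAddSubgroup p := by
  classical
  intro x hx
  rw [← DirectSum.sum_support_decompose 𝒜 x]
  exact sum_mem fun g _ => AddSubgroup.mem_iSup_of_mem g ⟨SetLike.coe_mem _, hp g hx⟩

theorem mem_anch_iff {r : ℕ} {R : Type u} [CommRing R] {𝒜 : (Fin r → ℤ) → AddSubgroup R}
    [SetLike.GradedMonoid 𝒜] (h𝒜 : IsGrading 𝒜) {p : Ideal R} [p.IsPrime]
    (hp : Submodule.toAddSubgroup p ≤ ⨆ g, 𝒜 g ⊓ Submodule.toAddSubgroup p)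
    (P : GrRes.{w} 𝒜 (quotDeg 𝒜 p)) [∀ n, Finite (P.ι n)]
    {M : Type v} [AddCommGroup M] [Module R M] {ℳ : (Fin r → ℤ) → AddSubgroup M}
    [SetLike.GradedSMul 𝒜 ℳ] (hℳ : IsGrading ℳ) (i : ℕ) (a : Fin (numDir 𝒜 p) → ℤ) :
    a ∈ anch 𝒜 p ℳ i ↔ ∃ n, dirMap 𝒜 p n = a ∧ ∃ d, (∃ s : homCompl 𝒜 p, (s : R) ∈ 𝒜 d) ∧
      P.StableClassAt (homCompl 𝒜 p) ℳ i (n + d) := by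
  rw [anch, Set.mem_ofPred_eq, coarsen_ne_bot_iff]
  simp only [starExtDeg_resField_ne_bot_iff h𝒜 hp P hℳ]

end MultiGraded

end

open MultiGraded in
theorem theorem2p10 {r : ℕ} {R : Type*} [CommRing R] [IsNoetherianRing R]
    (𝒜 : (Fin r → ℤ) → AddSubgroup R) [GradedRing 𝒜]
    (hpos : MultiGraded.IsPositivelyGraded 𝒜) (hstd : MultiGraded.IsStandard 𝒜)
    {M : Type*} [AddCommGroup M] [Module R M]
    (ℳ : (Fin r → ℤ) → AddSubgroup M) [DirectSum.Decomposition ℳ] [SetLike.GradedSMul 𝒜 ℳ]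
    (i : ℕ) (p : Ideal R) [p.IsPrime] (hp : p.IsHomogeneous 𝒜)
    (hp1 : Ideal.span (𝒜 1 : Set R) ≤ p) :
    (∃ h : MultiGraded.numDir (MultiGraded.coarsen (MultiGraded.dirMap 𝒜 p) 𝒜) p
          = MultiGraded.numDir 𝒜 p,
      MultiGraded.anch 𝒜 p ℳ i =
        {a | a ∘ Fin.cast h ∈
          MultiGraded.anch (MultiGraded.coarsen (MultiGraded.dirMap 𝒜 p) 𝒜) p
            (MultiGraded.coarsen (MultiGraded.dirMap 𝒜 p) ℳ) i}) ∧
    (Module.Finite R M → (MultiGraded.anch 𝒜 p ℳ i).Finite) := by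
  have h𝒜 : IsGrading 𝒜 := .of_decomposition 𝒜
  have hℳ : IsGrading ℳ := .of_decomposition ℳ
  have hp' := graded_of_isHomogeneous hp
  obtain ⟨P, hP⟩ := exists_finite_resolution h𝒜 hp'
  have hPφ : ∀ n, Finite ((P.coarsen (dirMap 𝒜 p)).ι n) := hP
  have hdir := dir_coarsen h𝒜 hstd hp'
  refine ⟨⟨numDir_coarsen h𝒜 hstd hp', ?_⟩, fun hM => ?_⟩
  · ext a
    rw [Set.mem_ofPred_eq, mem_anch_iff h𝒜 hp' P hℳ, P.stableClassAt_coarsen_iff h𝒜 hℳ,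
      mem_anch_iff (h𝒜.coarsen _) (coarsen_graded hp' _) (P.coarsen (dirMap 𝒜 p))
        (hℳ.coarsen _)]
    -- On the coarsened side the direction map is mere reindexing, so the preimage `n` of `a ∘
    -- Fin.cast _` can only be `a`.
    simp only [dirMap_of_dir_eq_univ hdir (numDir_coarsen h𝒜 hstd hp')]
    constructor
    · exact fun h => ⟨a, rfl, h⟩
    · rintro ⟨n, hn, h⟩
      rwa [(finCongr
        (numDir_coarsen h𝒜 hstd hp')).surjective.injective_comp_right hn] at h
  · refine (P.finite_stable_degrees h𝒜 hℳ (dirMap 𝒜 p)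
      (fun g hg x hx => mem_of_dirMap_ne_zero h𝒜 hstd hp' hg hx) i).subset fun a ha => ?_
    exact (mem_anch_iff h𝒜 hp' P hℳ i a).mp ha
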